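/- Let $\Sigma$ be a finite alphabet. A \emph{parameterized problem} $(L,\kappa)$ consists of a language $L$ (a set of strings over $\Sigma$, or of pairs of strings) and a \emph{parameterization} $\kappa$ mapping each instance to a string, its parameter. A partial map $r$ on (tuples of) strings is \emph{nu-FPT-computable with respect to} a parameterization $\kappa$ if there are a function $f$ from parameters to $\mathbb{N}$ and a polynomial $p$ such that for every parameter $k$ there is an algorithm (Turing machine) $A_k$ which, for every $x\in\mathrm{dom}(r)$ with $\kappa(x)=k$, computes $r(x)$ on input $x$ within time $f(\kappa(x))\,p(|x|)$. It is \emph{FPT-computable with respect to} $\kappa$ if moreover $f$ can be chosen computable and one algorithm $A$ can serve as $A_k$ for all $k$. An \emph{FPT-reduction} (respectively \emph{nu-FPT-reduction}) from $(L,\kappa)$ to $(L',\kappa')$ is a total map $g$ from instances to instances that is FPT-computable (respectively nu-FPT-computable) with respect to $\kappa$, together with a computable (respectively arbitrary) map $h$ from parameters to finite sets of parameters, such that for every instance $x$: $x\in L\Leftrightarrow g(x)\in L'$, and $\kappa'(g(x))\in h(\kappa(x))$. A \emph{case problem} $Q[S]$ consists of $Q\subseteq\Sigma^*\times\Sigma^*$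 and $S\subseteq\Sigma^*$. Write $Q_S = Q\cap(S\times\Sigma^*)$; then $\mathrm{param}\text{-}Q[S]$ is the parameterized problem $(Q_S,\pi_1)$ with instances in $\Sigma^*\times\Sigma^*$ and $\pi_1(s,y)=s$. The case problem $Q[S]$ \emph{slice reduces} to $Q'[S']$ if there are a computably enumerable $U\subseteq\Sigma^*\times\Sigma^*$ and a partial function $r:\Sigma^*\times\Sigma^*\times\Sigma^*\to\Sigma^*$ with $\mathrm{dom}(r)=U\times\Sigma^*$ that is FPT-computable with respect to the parameterization $(s,s',y)\mapsto(s,s')$, such that (coverage) for each $s\in S$ there is $s'\in S'$ with $(s,s')\in U$; and (correctness) for all $(t,t')\in U$ and $y\in\Sigma^*$, $(t,y)\in Q\Leftrightarrow(t',r(t,t',y))\in Q'$. \textbf{Theorem.} Let $Q[S]$ and $Q'[S']$ be case problems with $Q'_{S'}\neq\Sigma^*\times\Sigma^*$, and suppose that $Q[S]$ slice reduces to $Q'[S']$. Then $\mathrm{param}\text{-}Q[S]$ nu-FPT-reduces to $\mathrm{param}\text{-}Q'[S']$. If in addition $S$ and $S'$ are computable, then $\mathrm{param}\text{-}Q[S]$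 FPT-reduces to $\mathrm{param}\text{-}Q'[S']$. -/

import Mathlib

namespace SliceReduction

/-- Canonical representation of the elements of `α` as words over `Option A`, that is, over the
alphabet `A` together with one separator symbol `none`. This is the form in which elements of `α`
are given to and returned by algorithms. -/
class WordCoding (A : Type) (α : Type) where
  code : α → List (Option A)
  code_injective : Function.Injective code

/-- A word over `A` represents itself. -/
instance wordCodingList (A : Type) : WordCoding A (List A) where
  code x := x.map some
  code_injective := List.map_injective_iff.2 (Option.some_injective A)

/-- The pair `(x, b)` is written as `x`, followed by the separator, followed by `b`. -/
instance wordCodingProd (A α : Type) [WordCoding A α] : WordCoding A (List A × α) where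
  code p := p.1.map some ++ none :: WordCoding.code p.2
  code_injective := by
    rintro ⟨x, b⟩ ⟨x', b'⟩ h
    dsimp only at h
    induction x generalizing x' with
    | nil =>
      cases x' with
      | nil =>
        have hb : WordCoding.code (A := A) b = WordCoding.code b' := by simpa using h
        rw [WordCoding.code_injective hb]
      | cons c x' => simp at h
    | cons c x ih =>
      cases x' with
      | nil => simp at h
      | cons c' x' =>
        simp only [List.map_cons, List.cons_append, List.cons.injEq, Option.some.injEq] at h
        obtain ⟨rfl, h⟩ := h
        have := ih x' h
        simp only [Prod.mk.injEq] at this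
        obtain ⟨rfl, rfl⟩ := this
        rfl

/-- The length `|x|` of an input. -/
def size (A : Type) {α : Type} [WordCoding A α] (x : α) : ℕ :=
  (WordCoding.code (A := A) x).length

/-- An algorithm: a multi-stack Turing machine (Mathlib's `Turing.FinTM2`) whose input and output
alphabets are `A` together with the separator. -/
abbrev Algorithm (A : Type) : Type 1 :=
  Turing.TM2ComputableAux (Option A) (Option A)

/-- Started on `x`, the machine `M` halts with output `y` after at most `t` steps. -/
def Algorithm.ComputesWithin {A α β : Type} [WordCoding A α] [WordCoding A β]
    (M : Algorithm A) (x : α) (y : β) (t : ℕ) : Prop :=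
  Nonempty (Turing.TM2OutputsInTime M.tm
    ((WordCoding.code x).map M.inputAlphabet.symm)
    (some ((WordCoding.code y).map M.outputAlphabet.symm)) t)

section Computability

variable (A : Type) {α β P : Type} [WordCoding A α] [WordCoding A β]

/-- `r` is nu-FPT-computable with respect to the parameterization `κ`. Nothing is required of the
algorithms on inputs outside the domain of `r`. -/
def NuFPTComputable (κ : α → P) (r : α →. β) : Prop :=
  ∃ (f : P → ℕ) (p : Polynomial ℕ), ∀ k : P, ∃ M : Algorithm A,
    ∀ x : α, κ x = k → ∀ y ∈ r x, M.ComputesWithin x y (f (κ x) * p.eval (size A x))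

/-- `r` is FPT-computable with respect to the parameterization `κ`: the function `f` is computable
and a single algorithm serves for all parameter values. -/
def FPTComputable [Primcodable P] (κ : α → P) (r : α →. β) : Prop :=
  ∃ (f : P → ℕ) (p : Polynomial ℕ) (M : Algorithm A), Computable f ∧
    ∀ k : P, ∀ x : α, κ x = k → ∀ y ∈ r x,
      M.ComputesWithin x y (f (κ x) * p.eval (size A x))

end Computability

/-- A parameterized problem with instances in `α` and parameters in `P`. -/
structure ParamProblem (α P : Type) where
  lang : Set α
  param : α → P

/-- A finite-set-valued mapping is computable if a list of the elements of `h k` can be computed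
from `k`. -/
def ComputableFinset {P P' : Type} [Primcodable P] [Primcodable P'] (h : P → Finset P') : Prop :=
  ∃ l : P → List P', Computable l ∧ ∀ k y, y ∈ h k ↔ y ∈ l k

section Reductions

variable (A : Type) {α β P P' : Type} [WordCoding A α] [WordCoding A β]

/-- There is a nu-FPT-reduction from the first parameterized problem to the second. -/
def NuFPTReduces (X : ParamProblem α P) (Y : ParamProblem β P') : Prop :=
  ∃ (g : α → β) (h : P → Finset P'),
    NuFPTComputable A X.param (g : α →. β) ∧
    (∀ x, x ∈ X.lang ↔ g x ∈ Y.lang) ∧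
    (∀ x, Y.param (g x) ∈ h (X.param x))

/-- There is an FPT-reduction from the first parameterized problem to the second. -/
def FPTReduces [Primcodable P] [Primcodable P'] (X : ParamProblem α P) (Y : ParamProblem β P') :
    Prop :=
  ∃ (g : α → β) (h : P → Finset P'),
    FPTComputable A X.param (g : α →. β) ∧ ComputableFinset h ∧
    (∀ x, x ∈ X.lang ↔ g x ∈ Y.lang) ∧
    (∀ x, Y.param (g x) ∈ h (X.param x))

end Reductions

/-- A case problem `Q[S]` over the alphabet `A`. -/
structure CaseProblem (A : Type) where
  Q : Set (List A × List A)
  S : Set (List A)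

/-- The parameterized problem `param-Q[S] = (Q_S, π₁)`, where `Q_S = Q ∩ (S × A*)`. -/
def CaseProblem.toParam {A : Type} (X : CaseProblem A) : ParamProblem (List A × List A) (List A) where
  lang := X.Q ∩ (X.S ×ˢ Set.univ)
  param := Prod.fst

/-- `(U, r)` is a slice reduction from `X` to `Y`. -/
structure IsSliceReduction {A : Type} [Primcodable A] (X Y : CaseProblem A)
    (U : Set (List A × List A)) (r : List A × List A × List A →. List A) : Prop where
  enumerable : REPred fun u => u ∈ U
  dom_eq : r.Dom = {x | (x.1, x.2.1) ∈ U}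
  fptComputable : FPTComputable A (fun x : List A × List A × List A => (x.1, x.2.1)) r
  coverage : ∀ s ∈ X.S, ∃ s' ∈ Y.S, (s, s') ∈ U
  correctness : ∀ t t', (t, t') ∈ U → ∀ y, ∀ z ∈ r (t, t', y), ((t, y) ∈ X.Q ↔ (t', z) ∈ Y.Q)

/-- The case problem `X` slice reduces to the case problem `Y`. -/
def SliceReduces {A : Type} [Primcodable A] (X Y : CaseProblem A) : Prop :=
  ∃ (U : Set (List A × List A)) (r : List A × List A × List A →. List A), IsSliceReduction X Y U r

end SliceReduction

namespace SliceReduction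

/-! Choose a partial map `e` on parameters, defined exactly on `S`, with `e s ∈ S'` and `(s, e s) ∈
U`; coverage provides it. Fix `p₀` outside `Q'_{S'}`. The reduction sends `(s, y)` to `(s', r(s, s',
y))` when `e s = s'`, and to `p₀` when `e s` is undefined. Correctness of the slice reduction gives
the equivalence on defined parameters; off `S` both sides are no-instances. The new parameter
depends on `s` alone, so `h` is singleton-valued.

If `S` and `S'` are decidable, `e` can be made computable: test `s ∈ S`, then dovetail over
candidates `s' ∈ S'` and stages of the enumeration of `U` (`exists_computable_selection`). Without
decidability, `e` comes from choice, and the algorithm for the parameter `k` uses the constant,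
hence computable, map with value `e k`. Both cases thus rest on `exists_combined_machine`.

What remains is to realize this by actual Turing machines within the time bound. A computable `e` is
turned into a machine `E` on binary codes of words (`exists_machine_of_computable`), with a running
time that is itself computable, since a halting run can be simulated and its steps counted. The
machine `combined` runs `E` on `s`, then the given `M` on `(s, s', y)`, and prefixes `s'` to the
result. The cost of `E` and the length of `s'` depend only on `s`, so they go into the parameter
factor; `eval_add_le` separates their effect on the polynomial bound of `M`. -/

/-! ### Counting steps of deterministic transition systems -/

/-- `f` leads from `a` to `b` in exactly `n` steps. -/
def Steps {σ : Type} (f : σ → Option σ) : ℕ → σ → σ → Prop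
  | 0, a, b => a = b
  | n + 1, a, b => ∃ c, f a = some c ∧ Steps f n c b

namespace Steps

variable {σ : Type} {f : σ → Option σ}

theorem trans {m n : ℕ} {a b c : σ} (h₁ : Steps f m a b) (h₂ : Steps f n b c) :
    Steps f (m + n) a c := by
  induction m generalizing a with
  | zero => cases h₁; simpa using h₂
  | succ m ih =>
    obtain ⟨d, hd, h₁⟩ := h₁
    rw [Nat.succ_add]
    exact ⟨d, hd, ih h₁⟩

theorem single {a b : σ} (h : f a = some b) : Steps f 1 a b :=
  ⟨b, h, rfl⟩

theorem head {n : ℕ} {a b c : σ} (h : f a = some b) (h₂ : Steps f n b c) : Steps f (n + 1) a c :=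
  ⟨b, h, h₂⟩

theorem bind_iterate_none (f : σ → Option σ) (n : ℕ) : (flip bind f)^[n] none = none := by
  induction n with
  | zero => rfl
  | succ n ih => rw [Function.iterate_succ_apply]; exact ih

theorem iff_iterate {n : ℕ} {a b : σ} : Steps f n a b ↔ (flip bind f)^[n] (some a) = some b := by
  induction n generalizing a with
  | zero => simp [Steps]
  | succ n ih =>
    rw [Function.iterate_succ_apply]
    have : flip bind f (some a) = f a := rfl
    rw [this]
    cases h : f a with
    | none => rw [bind_iterate_none]; simp [Steps, h]
    | some c => simp [Steps, h, ih]

theorem unique {m n : ℕ} {a b c : σ} (h₁ : Steps f m a b) (h₂ : Steps f n a c) (hb : f b = none)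
    (hc : f c = none) : m = n ∧ b = c := by
  induction m generalizing a n with
  | zero =>
    cases h₁
    cases n with
    | zero => exact ⟨rfl, h₂⟩
    | succ n => obtain ⟨d, hd, -⟩ := h₂; simp [hb] at hd
  | succ m ih =>
    obtain ⟨d, hd, h₁⟩ := h₁
    cases n with
    | zero => cases h₂; simp [hc] at hd
    | succ n =>
      obtain ⟨d', hd', h₂⟩ := h₂
      cases hd.symm.trans hd'
      obtain ⟨rfl, rfl⟩ := ih h₁ h₂
      exact ⟨rfl, rfl⟩

theorem exists_of_reaches {a b : σ} (h : StateTransition.Reaches f a b) : ∃ n, Steps f n a b := by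
  induction h using Relation.ReflTransGen.head_induction_on with
  | refl => exact ⟨0, rfl⟩
  | head h _ ih =>
    obtain ⟨n, hn⟩ := ih
    exact ⟨n + 1, _, h, hn⟩

end Steps

theorem outputsInTime_iff {tm : Turing.FinTM2} {l : List (tm.Γ tm.k₀)} {l' : List (tm.Γ tm.k₁)}
    {t : ℕ} : Nonempty (Turing.TM2OutputsInTime tm l (some l') t) ↔
      ∃ n ≤ t, Steps (Turing.TM2.step tm.m) n (Turing.initList tm l) (Turing.haltList tm l') := by
  constructor
  · rintro ⟨⟨n, h⟩, hn⟩
    exact ⟨n, hn, Steps.iff_iterate.2 h⟩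
  · rintro ⟨n, hn, h⟩
    exact ⟨⟨⟨n, Steps.iff_iterate.1 h⟩, hn⟩⟩

/-! ### Embedding a machine into a larger one -/

section Lift

open Turing TM2.Stmt

variable {K₁ K₂ : Type} [DecidableEq K₁] [DecidableEq K₂] {Γ : K₂ → Type} {Λ₁ Λ₂ σ₁ σ₂ : Type}
  (ι : K₁ → K₂) (get : σ₂ → σ₁) (put : σ₁ → σ₂ → σ₂) (lab : Λ₁ → Λ₂) (exit : Option Λ₂)

/-- Run a statement on the stacks indexed by `K₁` of a bigger machine, whose internal state
contains that of the smaller one. Instead of halting, continue at `exit`. -/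
def liftStmt : TM2.Stmt (fun k => Γ (ι k)) Λ₁ σ₁ → TM2.Stmt Γ Λ₂ σ₂
  | push k f q => push (ι k) (fun v => f (get v)) (liftStmt q)
  | peek k f q => peek (ι k) (fun v o => put (f (get v) o) v) (liftStmt q)
  | pop k f q => pop (ι k) (fun v o => put (f (get v) o) v) (liftStmt q)
  | load f q => load (fun v => put (f (get v)) v) (liftStmt q)
  | branch f q₁ q₂ => branch (fun v => f (get v)) (liftStmt q₁) (liftStmt q₂)
  | goto f => goto (fun v => lab (f (get v)))
  | halt => exit.elim halt (fun l => goto fun _ => l)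

/-- The configuration `c₂` of the bigger machine represents the configuration `c₁` of the smaller
one; the remaining data are as in `v₀` and `S₀`. -/
structure Represents (v₀ : σ₂) (S₀ : ∀ k, List (Γ k)) (c₁ : TM2.Cfg (fun k => Γ (ι k)) Λ₁ σ₁)
    (c₂ : TM2.Cfg Γ Λ₂ σ₂) : Prop where
  label : c₂.l = c₁.l.elim exit (fun l => some (lab l))
  var : c₂.var = put c₁.var v₀
  stk : ∀ k, c₂.stk (ι k) = c₁.stk k
  rest : ∀ k, k ∉ Set.range ι → c₂.stk k = S₀ k

variable {ι get put lab exit}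

/-- The laws for `get` and `put`, with injectivity of `ι`, confine the lifted statement to its own
part of the state and of the stacks. -/
theorem represents_stepAux (hι : Function.Injective ι) (hget : ∀ a v, get (put a v) = a)
    (hput : ∀ a b v, put a (put b v) = put a v) {v₀ : σ₂} {S₀ : ∀ k, List (Γ k)}
    (q : TM2.Stmt (fun k => Γ (ι k)) Λ₁ σ₁) (a : σ₁) (S₁ : ∀ k, List (Γ (ι k)))
    (S₂ : ∀ k, List (Γ k)) (hS : ∀ k, S₂ (ι k) = S₁ k)
    (hrest : ∀ k, k ∉ Set.range ι → S₂ k = S₀ k) :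
    Represents ι put lab exit v₀ S₀ (TM2.stepAux q a S₁)
      (TM2.stepAux (liftStmt ι get put lab exit q) (put a v₀) S₂) := by
  induction q generalizing a S₁ S₂ with
  | push k f q ih =>
    simp only [liftStmt, TM2.stepAux]
    refine ih _ _ _ (fun k' => ?_) (fun k' hk' => ?_)
    · by_cases h : k' = k
      · subst h; simp [hS, hget]
      · rw [Function.update_of_ne (hι.ne h), Function.update_of_ne h, hS]
    · rw [Function.update_of_ne (fun h => hk' ⟨k, h.symm⟩), hrest _ hk']
  | peek k f q ih =>
    simp only [liftStmt, TM2.stepAux, hput, hget, hS]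
    exact ih _ _ _ hS hrest
  | pop k f q ih =>
    simp only [liftStmt, TM2.stepAux, hput, hget]
    rw [hS]
    refine ih _ _ _ (fun k' => ?_) (fun k' hk' => ?_)
    · by_cases h : k' = k
      · subst h; simp
      · rw [Function.update_of_ne (hι.ne h), Function.update_of_ne h, hS]
    · rw [Function.update_of_ne (fun h => hk' ⟨k, h.symm⟩), hrest _ hk']
  | load f q ih =>
    simp only [liftStmt, TM2.stepAux, hput, hget]
    exact ih _ _ _ hS hrest
  | branch f q₁ q₂ ih₁ ih₂ =>
    simp only [liftStmt, TM2.stepAux, hget]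
    cases f a
    · exact ih₂ _ _ _ hS hrest
    · exact ih₁ _ _ _ hS hrest
  | goto f =>
    simp only [liftStmt, TM2.stepAux, hget]
    exact ⟨rfl, rfl, hS, hrest⟩
  | halt =>
    cases exit <;> exact ⟨rfl, rfl, hS, hrest⟩

/-- The invariant `P` allows the two programs to agree only on the labels that can be reached; this
is what permits cutting an infinite label type down to a finite one. -/
theorem represents_steps (hι : Function.Injective ι) (hget : ∀ a v, get (put a v) = a)
    (hput : ∀ a b v, put a (put b v) = put a v) {m₁ : Λ₁ → TM2.Stmt (fun k => Γ (ι k)) Λ₁ σ₁}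
    {m₂ : Λ₂ → TM2.Stmt Γ Λ₂ σ₂} (P : Λ₁ → Prop)
    (hP : ∀ c c', TM2.step m₁ c = some c' → (∀ l ∈ c.l, P l) → ∀ l ∈ c'.l, P l)
    (hm : ∀ l, P l → m₂ (lab l) = liftStmt ι get put lab exit (m₁ l))
    {v₀ : σ₂} {S₀ : ∀ k, List (Γ k)} {n : ℕ} {c₁ c₁' : TM2.Cfg (fun k => Γ (ι k)) Λ₁ σ₁}
    {c₂ : TM2.Cfg Γ Λ₂ σ₂} (h : Steps (TM2.step m₁) n c₁ c₁') (hc : ∀ l ∈ c₁.l, P l)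
    (hr : Represents ι put lab exit v₀ S₀ c₁ c₂) :
    ∃ c₂', Steps (TM2.step m₂) n c₂ c₂' ∧ Represents ι put lab exit v₀ S₀ c₁' c₂' := by
  induction n generalizing c₁ c₂ with
  | zero => cases h; exact ⟨c₂, rfl, hr⟩
  | succ n ih =>
    obtain ⟨d, hd, h⟩ := h
    have hd' := hP _ _ hd hc
    obtain ⟨_ | l, a, S₁⟩ := c₁
    · simp at hd
    · obtain ⟨l₂, v, S₂⟩ := c₂
      obtain ⟨hl, hv, hS, hrest⟩ := hr
      simp only [Option.elim] at hl hv hS hrest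
      subst hl hv
      simp only [TM2.step, Option.some.injEq] at hd
      subst hd
      obtain ⟨c₂', h', hr'⟩ := ih h hd'
        (represents_stepAux (lab := lab) (exit := exit) hι hget hput (m₁ l) a S₁ S₂ hS hrest)
      refine ⟨c₂', Steps.head ?_ h', hr'⟩
      rw [TM2.step, hm l (hc l rfl)]

end Lift

/-! ### Computability of running times -/

open Turing PartrecToTM2

/-- An arbitrary coding of a finite type. -/
noncomputable abbrev finitePrimcodable (α : Type) [Finite α] : Primcodable α :=
  Primcodable.ofEquiv _ (Finite.equivFin α)

noncomputable instance : Primcodable Γ' := finitePrimcodable Γ'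

instance : Fintype K' := ⟨{.main, .rev, .aux, .stack}, fun k => by cases k <;> decide⟩

theorem elim_stacks (S : K' → List Γ') : K'.elim (S .main) (S .rev) (S .aux) (S .stack) = S := by
  funext k; cases k <;> rfl

section Clock

variable {Λ σ : Type}

/-- The data of a configuration with stacks indexed by `K'`. -/
abbrev StackCode (Λ σ : Type) : Type :=
  Option Λ × σ × List Γ' × List Γ' × List Γ' × List Γ'

def toStackCode (c : TM2.Cfg (fun _ : K' => Γ') Λ σ) : StackCode Λ σ :=
  (c.l, c.var, c.stk .main, c.stk .rev, c.stk .aux, c.stk .stack)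

/-- The stacks of a configuration. -/
def StackCode.stk (z : σ × List Γ' × List Γ' × List Γ' × List Γ') : K' → List Γ' :=
  K'.elim z.2.1 z.2.2.1 z.2.2.2.1 z.2.2.2.2

/-- Replace the stack `k` and the internal state. -/
def StackCode.set (z : σ × List Γ' × List Γ' × List Γ' × List Γ') (v : σ) (x : List Γ') :
    K' → σ × List Γ' × List Γ' × List Γ' × List Γ'
  | .main => (v, x, z.2.2)
  | .rev => (v, z.2.1, x, z.2.2.2)
  | .aux => (v, z.2.1, z.2.2.1, x, z.2.2.2.2)
  | .stack => (v, z.2.1, z.2.2.1, z.2.2.2.1, x)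

theorem StackCode.set_fst (z : σ × List Γ' × List Γ' × List Γ' × List Γ') (v : σ) (x : List Γ')
    (k : K') : (StackCode.set z v x k).1 = v := by
  cases k <;> rfl

theorem StackCode.stk_set (z : σ × List Γ' × List Γ' × List Γ' × List Γ') (v : σ) (x : List Γ')
    (k : K') : StackCode.stk (StackCode.set z v x k) = Function.update (StackCode.stk z) k x := by
  cases k <;> simp [StackCode.set, StackCode.stk]

/-- One step of the machine `m`, with halting configurations as fixed points. -/
def nextCode (m : Λ → TM2.Stmt (fun _ : K' => Γ') Λ σ) (z : StackCode Λ σ) : StackCode Λ σ :=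
  z.1.elim z fun l => toStackCode (TM2.stepAux (m l) z.2.1 (StackCode.stk z.2))

/-- The total map idles after halting, so `n` iterates amount to `n` genuine steps or to fewer steps
ending in a halt. -/
theorem exists_steps_nextCode (m : Λ → TM2.Stmt (fun _ : K' => Γ') Λ σ) (n : ℕ)
    (c : TM2.Cfg (fun _ : K' => Γ') Λ σ) :
    ∃ j ≤ n, ∃ c', Steps (TM2.step m) j c c' ∧ (nextCode m)^[n] (toStackCode c) = toStackCode c' ∧
      (c'.l = none ∨ j = n) := by
  induction n generalizing c with
  | zero => exact ⟨0, le_rfl, c, rfl, rfl, .inr rfl⟩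
  | succ n ih =>
    rw [Function.iterate_succ_apply]
    obtain ⟨_ | l, v, S⟩ := c
    · refine ⟨0, n.succ.zero_le, _, rfl, ?_, .inl rfl⟩
      have : nextCode m (toStackCode ⟨none, v, S⟩) = toStackCode ⟨none, v, S⟩ := rfl
      rw [this, Function.iterate_fixed this]
    · obtain ⟨j, hj, c', h₁, h₂, h₃⟩ := ih (TM2.stepAux (m l) v S)
      refine ⟨j + 1, by omega, c', Steps.head rfl h₁, ?_, h₃.imp_right (by omega)⟩
      rw [← h₂]
      congr 1
      simp only [nextCode, toStackCode, StackCode.stk, elim_stacks, Option.elim]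

/-- The running time, as a partial function of the initial data. -/
noncomputable def haltingTime (m : Λ → TM2.Stmt (fun _ : K' => Γ') Λ σ) (z : StackCode Λ σ) :
    Part ℕ :=
  Nat.rfind fun n => Part.some ((nextCode m)^[n] z).1.isNone

/-- The given run makes the search for a halted iterate succeed; by determinism the run found is the
given one. -/
theorem exists_haltingTime (m : Λ → TM2.Stmt (fun _ : K' => Γ') Λ σ) {n : ℕ}
    {c c' : TM2.Cfg (fun _ : K' => Γ') Λ σ} (h : Steps (TM2.step m) n c c') (hc' : c'.l = none) :
    ∃ t ∈ haltingTime m (toStackCode c), n ≤ t := by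
  have halted : ∀ d : TM2.Cfg (fun _ : K' => Γ') Λ σ, d.l = none → TM2.step m d = none := by
    rintro ⟨_ | l, v, S⟩ hd
    · rfl
    · cases hd
  have hn : ((nextCode m)^[n] (toStackCode c)).1.isNone = true := by
    obtain ⟨j, hj, d, h₁, h₂, h₃⟩ := exists_steps_nextCode m n c
    rw [h₂]
    have : d.l = none := by
      rcases h₃ with h₃ | rfl
      · exact h₃
      · rw [Steps.iff_iterate] at h h₁
        cases h.symm.trans h₁
        exact hc'
    simp [toStackCode, this]
  obtain ⟨t, ht, -⟩ := Nat.rfind_min' (p := fun n => ((nextCode m)^[n] (toStackCode c)).1.isNone) hn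
  refine ⟨t, ht, ?_⟩
  have hs := Nat.rfind_spec ht
  obtain ⟨j, hj, d, h₁, h₂, h₃⟩ := exists_steps_nextCode m t c
  have hd : d.l = none := by
    simp only [PFun.coe_val, Part.mem_some_iff] at hs
    rw [h₂] at hs
    simpa [toStackCode] using hs.symm
  obtain ⟨rfl, rfl⟩ := Steps.unique h h₁ (halted _ hc') (halted _ hd)
  exact hj

variable [Primcodable Λ] [Primcodable σ] [Finite σ]

open Primrec in
-- The functions inside a statement are arbitrary, but their arguments range over finite types,
-- where every function is primitive recursive. The stacks are only changed by list operations.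
theorem primrec_stepAux (q : TM2.Stmt (fun _ : K' => Γ') Λ σ) :
    Primrec fun z : σ × List Γ' × List Γ' × List Γ' × List Γ' =>
      toStackCode (TM2.stepAux q z.1 (StackCode.stk z)) := by
  have p1 : Primrec fun z : σ × List Γ' × List Γ' × List Γ' × List Γ' => z.2.1 := fst.comp snd
  have p2 : Primrec fun z : σ × List Γ' × List Γ' × List Γ' × List Γ' => z.2.2.1 :=
    fst.comp (snd.comp snd)
  have p3 : Primrec fun z : σ × List Γ' × List Γ' × List Γ' × List Γ' => z.2.2.2.1 :=
    fst.comp (snd.comp (snd.comp snd))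
  have p4 : Primrec fun z : σ × List Γ' × List Γ' × List Γ' × List Γ' => z.2.2.2.2 :=
    snd.comp (snd.comp (snd.comp snd))
  have pk : ∀ k, Primrec fun z : σ × List Γ' × List Γ' × List Γ' × List Γ' =>
      StackCode.stk z k := by
    intro k; cases k
    exacts [p1, p2, p3, p4]
  have dom : ∀ (f : σ → Option Γ' → σ) (k : K'), Primrec
      fun z : σ × List Γ' × List Γ' × List Γ' × List Γ' => f z.1 (StackCode.stk z k).head? :=
    fun f k => (dom_finite fun a : σ × Option Γ' => f a.1 a.2).comp
      (fst.pair (list_head?.comp (pk k)))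
  have upd : ∀ (k : K') {f : σ × List Γ' × List Γ' × List Γ' × List Γ' → List Γ'}
      {g : σ × List Γ' × List Γ' × List Γ' × List Γ' → σ}, Primrec f → Primrec g →
      Primrec fun z : σ × List Γ' × List Γ' × List Γ' × List Γ' =>
        StackCode.set z (g z) (f z) k := by
    intro k f g hf hg
    cases k
    · exact hg.pair (hf.pair (snd.comp snd))
    · exact hg.pair (p1.pair (hf.pair (snd.comp (snd.comp snd))))
    · exact hg.pair (p1.pair (p2.pair (hf.pair p4)))
    · exact hg.pair (p1.pair (p2.pair (p3.pair hf)))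
  induction q with
  | push k f q ih =>
    refine (ih.comp (upd k (list_cons.comp ((dom_finite f).comp fst) (pk k)) fst)).of_eq
      fun z => ?_
    rw [StackCode.stk_set, StackCode.set_fst]
    rfl
  | peek k f q ih =>
    refine (ih.comp ((dom f k).pair snd)).of_eq fun z => ?_
    rfl
  | pop k f q ih =>
    refine (ih.comp (upd k (list_tail.comp (pk k)) (dom f k))).of_eq fun z => ?_
    rw [StackCode.stk_set, StackCode.set_fst]
    rfl
  | load f q ih => exact ih.comp (((dom_finite f).comp fst).pair snd)
  | branch f q₁ q₂ ih₁ ih₂ =>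
    refine (Primrec.cond ((dom_finite f).comp fst) ih₁ ih₂).of_eq fun z => ?_
    simp only [TM2.stepAux]
    cases f z.1 <;> rfl
  | goto f => exact ((option_some.comp ((dom_finite f).comp fst)).pair .id)
  | halt => exact ((Primrec.const none).pair .id)

/-- A function of two variables, the first of which ranges over a finite type, is primitive
recursive as soon as it is so in the second variable. -/
theorem primrec₂_of_finite {α β γ : Type} [Primcodable α] [Finite α] [Primcodable β]
    [Primcodable γ] [Inhabited γ] {f : α → β → γ} (h : ∀ a, Primrec (f a)) : Primrec₂ f := by
  classical
  have key : ∀ l : List α, Primrec fun x : α × β => if x.1 ∈ l then f x.1 x.2 else default := by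
    intro l
    induction l with
    | nil => simpa using Primrec.const default
    | cons a l ih =>
      refine (Primrec.ite (c := fun x : α × β => x.1 = a)
        (Primrec.eq.comp Primrec.fst (Primrec.const a)) ((h a).comp Primrec.snd) ih).of_eq
        fun x => ?_
      by_cases hx : x.1 = a <;> simp [hx]
  cases nonempty_fintype α
  have : Primrec fun x : α × β => f x.1 x.2 := (key Finset.univ.toList).of_eq fun x => by simp
  exact this.to₂

theorem primrec_nextCode [Finite Λ] [Inhabited σ] (m : Λ → TM2.Stmt (fun _ : K' => Γ') Λ σ) :
    Primrec (nextCode m) := by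
  have : Primrec₂ fun (l : Λ) (z : σ × List Γ' × List Γ' × List Γ' × List Γ') =>
      toStackCode (TM2.stepAux (m l) z.1 (StackCode.stk z)) :=
    primrec₂_of_finite fun l => primrec_stepAux (m l)
  refine (Primrec.option_casesOn (f := fun z : StackCode Λ σ => z)
    (g := fun z l => toStackCode (TM2.stepAux (m l) z.2.1 (StackCode.stk z.2))) Primrec.fst
    Primrec.id (this.comp Primrec.snd (Primrec.snd.comp Primrec.fst))).of_eq fun z => ?_
  obtain ⟨_ | l, z⟩ := z <;> rfl

theorem partrec_haltingTime [Finite Λ] [Inhabited σ]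
    (m : Λ → TM2.Stmt (fun _ : K' => Γ') Λ σ) : Partrec (haltingTime m) := by
  have : Primrec₂ fun (z : StackCode Λ σ) (n : ℕ) => ((nextCode m)^[n] z).1.isNone := by
    have h1 : Primrec fun p : StackCode Λ σ × ℕ => (nextCode m)^[p.2] p.1 :=
      Primrec.nat_iterate Primrec.snd Primrec.fst ((primrec_nextCode m).comp Primrec.snd).to₂
    have h2 : Primrec fun o : Option Λ => o.isNone := Primrec.dom_finite _
    exact (h2.comp (Primrec.fst.comp h1)).to₂
  exact Partrec.rfind this.to_comp.partrec₂

end Clock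

/-! ### Machines for partial recursive functions -/

open Turing.ToPartrec in
/-- The machine evaluating a code, as a machine with finitely many labels. -/
noncomputable def codeMachine (c : Code) : FinTM2 where
  K := K'
  k₀ := .main
  k₁ := .main
  Γ _ := Γ'
  Λ := {l // l ∈ codeSupp c .halt}
  main := ⟨trNormal c .halt, codeSupp_self _ _ (trStmts₁_self _)⟩
  σ := Option Γ'
  initialState := none
  Γk₀Fin := inferInstanceAs (Fintype Γ')
  m l := liftStmt (Γ := fun _ => Γ') (σ₁ := Option Γ') (Λ₁ := Λ') id id (fun a _ => a)
    (fun l => if h : l ∈ codeSupp c .halt then ⟨l, h⟩ else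
      ⟨trNormal c .halt, codeSupp_self _ _ (trStmts₁_self _)⟩) none (tr l)

open Turing.ToPartrec in
theorem codeMachine_initList (c : Code) (l : List Γ') :
    initList (codeMachine c) l =
      ⟨some (codeMachine c).main, none, K'.elim l [] [] []⟩ := by
  simp only [initList]
  congr 1
  funext k
  cases k <;> rfl

open Turing.ToPartrec in
theorem codeMachine_haltList (c : Code) (l : List Γ') :
    haltList (codeMachine c) l = ⟨none, none, K'.elim l [] [] []⟩ := by
  simp only [haltList]
  congr 1
  funext k
  cases k <;> rfl

open Turing.ToPartrec in
-- A run of the evaluator started at `trNormal c .halt` never leaves `codeSupp c .halt`, so the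
-- default label used outside the support plays no role.
theorem codeMachine_steps (c : Code) (v w : List ℕ) (h : w ∈ c.eval v) :
    ∃ n, Steps (TM2.step (codeMachine c).m) n (initList (codeMachine c) (trList v))
      (haltList (codeMachine c) (trList w)) := by
  have h₁ : PartrecToTM2.halt w ∈ StateTransition.eval (TM2.step tr) (PartrecToTM2.init c v) := by
    rw [PartrecToTM2.tr_eval]
    exact Part.mem_map _ h
  obtain ⟨n, hn⟩ := Steps.exists_of_reaches (StateTransition.mem_eval.1 h₁).1
  let _ : Inhabited Λ' := ⟨trNormal c .halt⟩
  have hsupp := tr_supports c .halt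
  obtain ⟨c', hc', hr⟩ := represents_steps (Γ := fun _ : K' => Γ') (ι := id) (get := id)
    (put := fun a _ => a)
    (lab := fun l => if h : l ∈ codeSupp c .halt then (⟨l, h⟩ : {l // l ∈ codeSupp c .halt}) else
      ⟨trNormal c .halt, codeSupp_self _ _ (trStmts₁_self _)⟩) (exit := none)
    (m₁ := tr) (m₂ := (codeMachine c).m) (v₀ := none) (S₀ := fun _ => [])
    Function.injective_id (fun _ _ => rfl) (fun _ _ _ => rfl) (fun l => l ∈ codeSupp c .halt)
    (fun d d' hd h => by
      have := TM2.step_supports tr hsupp hd (by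
        rw [Finset.mem_insertNone]; exact h)
      rwa [Finset.mem_insertNone] at this)
    (fun l hl => by rw [dif_pos hl]; rfl) hn
    (c₂ := initList (codeMachine c) (trList v))
    (by
      rintro l ⟨⟩
      exact codeSupp_self _ _ (trStmts₁_self _))
    (by
      rw [codeMachine_initList]
      refine ⟨?_, rfl, fun k => rfl, fun k hk => (hk ⟨k, rfl⟩).elim⟩
      simp only [PartrecToTM2.init, Option.elim]
      rw [dif_pos (codeSupp_self _ _ (trStmts₁_self _))]
      rfl)
  refine ⟨n, ?_⟩
  obtain ⟨l, v, S⟩ := c'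
  obtain ⟨hl, hv, hS, -⟩ := hr
  rw [codeMachine_haltList]
  simp only [PartrecToTM2.halt, Option.elim] at hl hv hS
  subst hl hv
  have : S = K'.elim (trList w) [] [] [] := funext hS
  subst this
  exact hc'

/-- Every partial recursive function is computed, on binary representations, by a machine whose
running time has a partial recursive bound. -/
theorem exists_machine_of_partrec {f : ℕ →. ℕ} (hf : Partrec f) :
    ∃ (E : TM2ComputableAux Γ' Γ') (T : List Γ' →. ℕ), Partrec T ∧ ∀ n, ∀ m ∈ f n,
      ∃ t ∈ T (trList [n]), Nonempty (TM2OutputsInTime E.tm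
        ((trList [n]).map E.inputAlphabet.symm)
        (some ((trList [m]).map E.outputAlphabet.symm)) t) := by
  obtain ⟨c, hc⟩ := ToPartrec.Code.exists_code (Nat.Partrec'.part_iff₁.2 hf)
  let _ : Primcodable {l // l ∈ codeSupp c .halt} := finitePrimcodable _
  let m : {l // l ∈ codeSupp c .halt} → TM2.Stmt (fun _ : K' => Γ') {l // l ∈ codeSupp c .halt}
    (Option Γ') := (codeMachine c).m
  have hT := partrec_haltingTime m
  refine ⟨⟨codeMachine c, Equiv.refl _, Equiv.refl _⟩,
    fun l => haltingTime m (toStackCode (initList (codeMachine c) l)), ?_, ?_⟩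
  · have h : Primrec fun l : List Γ' =>
        ((some (codeMachine c).main, none, l, [], [], []) : StackCode {l // l ∈ codeSupp c .halt} (Option Γ')) :=
      (Primrec.const _).pair ((Primrec.const _).pair (Primrec.id.pair (Primrec.const _)))
    exact (hT.comp h.to_comp).of_eq fun l => by rw [codeMachine_initList]; rfl
  · intro n k' hm
    obtain ⟨k, hk⟩ := codeMachine_steps c [n] [k'] (by
      have := hc (n ::ᵥ List.Vector.nil)
      have e : (n ::ᵥ List.Vector.nil).1 = [n] := rfl
      rw [e] at this
      rw [this]
      exact Part.mem_map _ hm)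
    obtain ⟨t, ht, hkt⟩ := exists_haltingTime m hk rfl
    refine ⟨t, ht, outputsInTime_iff.2 ⟨k, hkt, ?_⟩⟩
    have e : ∀ l : List Γ', l.map (Equiv.refl Γ').symm = l := fun l => List.map_id l
    exact (e (trList [n])).symm ▸ (e (trList [k'])).symm ▸ hk

/-! ### Standard configurations and binary codes of words -/

theorem initList_eq (tm : FinTM2) (l : List (tm.Γ tm.k₀)) :
    initList tm l = ⟨some tm.main, tm.initialState, Function.update (fun _ => []) tm.k₀ l⟩ := by
  simp only [initList]
  congr 1
  funext k
  by_cases h : k = tm.k₀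
  · subst h; simp
  · simp [h]

theorem haltList_eq (tm : FinTM2) (l : List (tm.Γ tm.k₁)) :
    haltList tm l = ⟨none, tm.initialState, Function.update (fun _ => []) tm.k₁ l⟩ := by
  simp only [haltList]
  congr 1
  funext k
  by_cases h : k = tm.k₁
  · subst h; simp
  · simp [h]

/-- Push the letters of a fixed word, one after the other. -/
def pushList {K : Type} {Γ : K → Type} {Λ σ : Type} (k : K) :
    List (Γ k) → TM2.Stmt Γ Λ σ → TM2.Stmt Γ Λ σ
  | [], q => q
  | x :: l, q => .push k (fun _ => x) (pushList k l q)

theorem stepAux_pushList {K : Type} [DecidableEq K] {Γ : K → Type} {Λ σ : Type} (k : K)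
    (l : List (Γ k)) (q : TM2.Stmt Γ Λ σ) (v : σ) (S : ∀ k, List (Γ k)) :
    TM2.stepAux (pushList k l q) v S =
      TM2.stepAux q v (Function.update S k (l.reverse ++ S k)) := by
  induction l generalizing S with
  | nil => simp [pushList]
  | cons x l ih => simp [pushList, ih]

/-- The position of a letter in the alphabet. -/
noncomputable def letterIdx {A : Type} [Fintype A] (a : A) : ℕ :=
  Fintype.equivFin A a

/-- The letter at a given position. -/
noncomputable def letterAt {A : Type} [Fintype A] (c : Fin (Fintype.card A + 2)) : Option A :=
  if h : c.1 < Fintype.card A then some ((Fintype.equivFin A).symm ⟨c.1, h⟩) else none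

/-- The counter showing `i`. -/
def counter (A : Type) [Fintype A] (i : ℕ) : Fin (Fintype.card A + 2) :=
  Fin.ofNat _ i

theorem counter_add_one (A : Type) [Fintype A] (i : ℕ) : counter A i + 1 = counter A (i + 1) := by
  ext
  simp [counter, Fin.val_add]

theorem letterAt_letterIdx {A : Type} [Fintype A] (a : A) :
    letterAt (counter A (letterIdx a)) = some a := by
  have h : letterIdx a < Fintype.card A := (Fintype.equivFin A a).2
  have h' : (counter A (letterIdx a)).val = letterIdx a := by
    simp only [counter, Fin.val_ofNat]
    rw [Nat.mod_eq_of_lt (by omega)]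
  unfold letterAt
  rw [dif_pos (by rw [h']; exact h)]
  have e : (⟨(counter A (letterIdx a)).val, by rw [h']; exact h⟩ : Fin (Fintype.card A)) =
      Fintype.equivFin A a := Fin.ext h'
  rw [e, Equiv.symm_apply_apply]

/-- The binary code of a letter. -/
noncomputable def letterBits {A : Type} [Fintype A] (a : A) : List Γ' :=
  List.replicate (letterIdx a) .bit1 ++ [.bit0]

/-- The binary code of a word. -/
noncomputable def wordBits {A : Type} [Fintype A] (s : List A) : List Γ' :=
  s.flatMap letterBits ++ [.bit1, .cons]

/-! ### The combined machine -/

section Machine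

/-- The auxiliary stacks of the combined machine. -/
inductive Store
  | arg | argCopy | res | resCopy
  deriving DecidableEq

instance : Fintype Store :=
  ⟨{.arg, .argCopy, .res, .resCopy}, fun k => by cases k <;> decide⟩

/-- The labels of the combined machine. -/
inductive Label (A Λ₁ Λ₂ : Type)
  | scan | encode | put (a : A) | runE (l : Λ₂) | decode | feedRes | feedArg | runM (l : Λ₁)
  | mark | emit | clear | clearArg
  deriving Fintype

variable {A : Type} (M : Algorithm A) (E : TM2ComputableAux Γ' Γ')

/-- The stack alphabets of the combined machine. -/
abbrev stackAlphabet : M.tm.K ⊕ E.tm.K ⊕ Store → Type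
  | .inl k => M.tm.Γ k
  | .inr (.inl k) => E.tm.Γ k
  | .inr (.inr _) => Option A

variable {M E}

/-- The stacks of the combined machine. -/
def stackVal (S : ∀ k, List (M.tm.Γ k)) (T : ∀ k, List (E.tm.Γ k)) (b b' d d' : List (Option A)) :
    ∀ k, List (stackAlphabet M E k)
  | .inl k => S k
  | .inr (.inl k) => T k
  | .inr (.inr .arg) => b
  | .inr (.inr .argCopy) => b'
  | .inr (.inr .res) => d
  | .inr (.inr .resCopy) => d'

variable {S : ∀ k, List (M.tm.Γ k)} {T : ∀ k, List (E.tm.Γ k)} {b b' d d' : List (Option A)}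

theorem update_stackVal_inl (k : M.tm.K) (x : List (M.tm.Γ k)) :
    Function.update (stackVal S T b b' d d') (.inl k) x =
      stackVal (Function.update S k x) T b b' d d' := by
  funext i
  obtain i | i | i | i | i | i := i
  · by_cases h : i = k
    · subst h; simp [stackVal]
    · simp [stackVal, h]
  all_goals simp [stackVal]

theorem update_stackVal_inr (k : E.tm.K) (x : List (E.tm.Γ k)) :
    Function.update (stackVal S T b b' d d') (.inr (.inl k)) x =
      stackVal S (Function.update T k x) b b' d d' := by
  funext i
  obtain i | i | i | i | i | i := i
  · simp [stackVal]
  · by_cases h : i = k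
    · subst h; simp [stackVal]
    · simp [stackVal, h]
  all_goals simp [stackVal]

theorem update_stackVal_arg (x : List (Option A)) :
    Function.update (stackVal S T b b' d d') (.inr (.inr .arg)) x = stackVal S T x b' d d' := by
  funext i
  obtain i | i | i | i | i | i := i <;> simp [stackVal]

theorem update_stackVal_argCopy (x : List (Option A)) :
    Function.update (stackVal S T b b' d d') (.inr (.inr .argCopy)) x = stackVal S T b x d d' := by
  funext i
  obtain i | i | i | i | i | i := i <;> simp [stackVal]

theorem update_stackVal_res (x : List (Option A)) :
    Function.update (stackVal S T b b' d d') (.inr (.inr .res)) x = stackVal S T b b' x d' := by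
  funext i
  obtain i | i | i | i | i | i := i <;> simp [stackVal]

theorem update_stackVal_resCopy (x : List (Option A)) :
    Function.update (stackVal S T b b' d d') (.inr (.inr .resCopy)) x = stackVal S T b b' d x := by
  funext i
  obtain i | i | i | i | i | i := i <;> simp [stackVal]

theorem stackVal_nil : stackVal (M := M) (E := E) (fun _ => []) (fun _ => []) [] [] [] [] =
    fun _ => [] := by
  funext i
  obtain i | i | i | i | i | i := i <;> rfl

end Machine

section Machine

variable {A : Type} [Fintype A] (M : Algorithm A) (E : TM2ComputableAux Γ' Γ')

/-- The internal states of the combined machine: those of its parts, the last letter and the last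
bit that were read, and a counter. -/
abbrev Register : Type :=
  M.tm.σ × E.tm.σ × Option (Option A) × Option Γ' × Fin (Fintype.card A + 2)

variable {M E}

namespace Register

def letter (v : Register M E) : Option (Option A) := v.2.2.1

def bit (v : Register M E) : Option Γ' := v.2.2.2.1

def count (v : Register M E) : Fin (Fintype.card A + 2) := v.2.2.2.2

def setLetter (v : Register M E) (x : Option (Option A)) : Register M E :=
  (v.1, v.2.1, x, v.2.2.2)

def setBit (v : Register M E) (x : Option Γ') : Register M E :=
  (v.1, v.2.1, v.2.2.1, x, v.2.2.2.2)

def setCount (v : Register M E) (x : Fin (Fintype.card A + 2)) : Register M E :=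
  (v.1, v.2.1, v.2.2.1, v.2.2.2.1, x)

end Register

variable (M E)

/-- The internal state in which the two parts are in their initial states. -/
def register (x : Option (Option A)) (g : Option Γ') (c : Fin (Fintype.card A + 2)) :
    Register M E :=
  (M.tm.initialState, E.tm.initialState, x, g, c)

open TM2.Stmt Register in
/-- The program of the combined machine. It computes `s'` from `s` by means of `E`, then applies `M`
to `(s, s', y)`, and finally puts `s'` in front of the result. If `E` returns the code of the number
zero, the output is the fixed word `w`. -/
noncomputable def program (w : List (Option A)) :
    Label A M.tm.Λ E.tm.Λ →
      TM2.Stmt (stackAlphabet M E) (Label A M.tm.Λ E.tm.Λ) (Register M E)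
  | .scan =>
    pop (.inl M.tm.k₀) (fun v o => v.setLetter (o.map M.inputAlphabet)) <|
      -- `join` treats the separator and the empty stack alike, as the end of a word. Reading
      -- destroys a stack, so `s` is stored twice: once to be encoded for `E`, once to be fed to
      -- `M`. The same is done with `s'` below.
      branch (fun v => v.letter.join.isSome)
        (push (.inr (.inr .arg)) (fun v => v.letter.join) <|
          push (.inr (.inr .argCopy)) (fun v => v.letter.join) <|
          goto fun _ => .scan)
        -- The end of `wordBits s` goes to the bottom; the letters of `s` are then added above it,
        -- last letter first.
        (push (.inr (.inl E.tm.k₀)) (fun _ => E.inputAlphabet.symm .cons) <|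
          push (.inr (.inl E.tm.k₀)) (fun _ => E.inputAlphabet.symm .bit1) <|
          goto fun _ => .encode)
  | .encode =>
    pop (.inr (.inr .arg)) (fun v o => v.setLetter o) <|
      goto fun v => v.letter.join.elim (.runE E.tm.main) .put
  | .put a =>
    pushList (.inr (.inl E.tm.k₀)) ((letterBits a).reverse.map E.inputAlphabet.symm) <|
      goto fun _ => .encode
  | .runE l =>
    liftStmt (Γ := stackAlphabet M E) (fun k => .inr (.inl k)) (fun v => v.2.1)
      (fun a v => (v.1, a, v.2.2)) .runE (some .decode) (E.tm.m l)
  | .decode =>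
    pop (.inr (.inl E.tm.k₁)) (fun v o => v.setBit (o.map E.outputAlphabet)) <|
      branch (fun v => v.bit = some .bit1)
        (load (fun v => v.setCount (v.count + 1)) <| goto fun _ => .decode) <|
      branch (fun v => v.bit = some .bit0)
        (push (.inr (.inr .res)) (fun v => letterAt v.count) <|
          push (.inr (.inr .resCopy)) (fun v => letterAt v.count) <|
          load (fun v => v.setCount (counter A 0)) <| goto fun _ => .decode) <|
      -- At `cons`, a counter at 1 stems from the closing `bit1` of a word code, while 0 means that
      -- `E` returned the number zero.
      branch (fun v => v.count = counter A 1)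
        (push (.inl M.tm.k₀) (fun _ => M.inputAlphabet.symm none) <| goto fun _ => .feedRes)
        (goto fun _ => .clear)
  | .feedRes =>
    pop (.inr (.inr .res)) (fun v o => v.setLetter o) <|
      branch (fun v => v.letter.join.isSome)
        (push (.inl M.tm.k₀) (fun v => M.inputAlphabet.symm v.letter.join) <|
          goto fun _ => .feedRes)
        (push (.inl M.tm.k₀) (fun _ => M.inputAlphabet.symm none) <| goto fun _ => .feedArg)
  | .feedArg =>
    pop (.inr (.inr .argCopy)) (fun v o => v.setLetter o) <|
      branch (fun v => v.letter.join.isSome)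
        (push (.inl M.tm.k₀) (fun v => M.inputAlphabet.symm v.letter.join) <|
          goto fun _ => .feedArg)
        (goto fun _ => .runM M.tm.main)
  | .runM l =>
    liftStmt (Γ := stackAlphabet M E) (fun k => .inl k) (fun v => v.1)
      (fun a v => (a, v.2)) .runM (some .mark) (M.tm.m l)
  | .mark =>
    push (.inl M.tm.k₁) (fun _ => M.outputAlphabet.symm none) <| goto fun _ => .emit
  | .emit =>
    pop (.inr (.inr .resCopy)) (fun v o => v.setLetter o) <|
      branch (fun v => v.letter.join.isSome)
        (push (.inl M.tm.k₁) (fun v => M.outputAlphabet.symm v.letter.join) <|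
          goto fun _ => .emit)
        (load (fun _ => register M E none none (counter A 0)) halt)
  -- `haltList` requires the initial internal state and empty stacks except for the output, so `y`
  -- and the copy of `s` must be erased.
  | .clear =>
    pop (.inl M.tm.k₀) (fun v o => v.setLetter (o.map M.inputAlphabet)) <|
      branch (fun v => v.letter.isSome) (goto fun _ => .clear) (goto fun _ => .clearArg)
  | .clearArg =>
    pop (.inr (.inr .argCopy)) (fun v o => v.setLetter o) <|
      branch (fun v => v.letter.isSome) (goto fun _ => .clearArg)
        (pushList (.inl M.tm.k₁) (w.reverse.map M.outputAlphabet.symm) <|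
          load (fun _ => register M E none none (counter A 0)) halt)

/-- The combined machine. -/
noncomputable def combined (w : List (Option A)) : Algorithm A where
  tm :=
    { K := M.tm.K ⊕ E.tm.K ⊕ Store
      kDecidableEq := inferInstance
      kFin := by
        have := M.tm.kFin
        have := E.tm.kFin
        exact inferInstance
      k₀ := .inl M.tm.k₀
      k₁ := .inl M.tm.k₁
      Γ := stackAlphabet M E
      Λ := Label A M.tm.Λ E.tm.Λ
      main := .scan
      ΛFin := by
        classical
        have := M.tm.ΛFin
        have := E.tm.ΛFin
        exact inferInstance
      σ := Register M E
      initialState := register M E none none (counter A 0)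
      σFin := by
        have := M.tm.σFin
        have := E.tm.σFin
        exact inferInstance
      Γk₀Fin := M.tm.Γk₀Fin
      m := program M E w }
  inputAlphabet := M.inputAlphabet
  outputAlphabet := M.outputAlphabet

variable {M E}

/-- All stacks are empty, except for `k`. -/
def single {K : Type} [DecidableEq K] {Γ : K → Type} (k : K) (l : List (Γ k)) : ∀ k, List (Γ k) :=
  Function.update (fun _ => []) k l

theorem single_self {K : Type} [DecidableEq K] {Γ : K → Type} (k : K) (l : List (Γ k)) :
    single k l k = l := by
  simp [single]

theorem update_single {K : Type} [DecidableEq K] {Γ : K → Type} (k : K) (l l' : List (Γ k)) :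
    Function.update (single k l) k l' = single k l' := by
  simp [single]

theorem single_nil {K : Type} [DecidableEq K] {Γ : K → Type} (k : K) :
    single (Γ := Γ) k [] = fun _ => [] := by
  simp [single]

theorem update_nil {K : Type} [DecidableEq K] {Γ : K → Type} (k : K) (l : List (Γ k)) :
    Function.update (fun _ => []) k l = single k l :=
  rfl

/-- A configuration in which the two parts are in their initial states. -/
def config (l : Option (Label A M.tm.Λ E.tm.Λ)) (x : Option (Option A)) (g : Option Γ')
    (c : Fin (Fintype.card A + 2)) (S : ∀ k, List (M.tm.Γ k)) (T : ∀ k, List (E.tm.Γ k))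
    (b b' d d' : List (Option A)) :
    TM2.Cfg (stackAlphabet M E) (Label A M.tm.Λ E.tm.Λ) (Register M E) :=
  ⟨l, register M E x g c, stackVal S T b b' d d'⟩

variable {w : List (Option A)} {x : Option (Option A)} {g : Option Γ'}
  {c : Fin (Fintype.card A + 2)} {S : ∀ k, List (M.tm.Γ k)} {T : ∀ k, List (E.tm.Γ k)}
  {b b' d d' : List (Option A)}

attribute [local simp] config program register Register.setLetter Register.letter Register.setBit
  Register.bit Register.setCount Register.count stackVal update_stackVal_inl update_stackVal_inr
  update_stackVal_arg update_stackVal_argCopy update_stackVal_res update_stackVal_resCopy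
  single_self update_single single_nil update_nil

/-! ### Runs of the combined machine -/

theorem steps_scan (s : List A) (y : List (M.tm.Γ M.tm.k₀)) :
    ∀ x b b', Steps (TM2.step (program M E w)) (s.length + 1)
      (config (some .scan) x g c
        (single M.tm.k₀ (s.map (fun a => M.inputAlphabet.symm (some a)) ++
          M.inputAlphabet.symm none :: y)) (fun _ => []) b b' d d')
      (config (some .encode) (some none) g c (single M.tm.k₀ y)
        (single E.tm.k₀ ([.bit1, .cons].map E.inputAlphabet.symm))
        (s.reverse.map some ++ b) (s.reverse.map some ++ b') d d') := by
  induction s with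
  | nil => intro x b b'; refine .single ?_; simp
  | cons a s ih =>
    intro x b b'
    refine .head ?_ (by simpa using ih (some (some a)) (some a :: b) (some a :: b'))
    simp

theorem steps_encode (r : List A) :
    ∀ x t, Steps (TM2.step (program M E w)) (2 * r.length + 1)
      (config (some .encode) x g c S (single E.tm.k₀ t) (r.map some) b' d d')
      (config (some (.runE E.tm.main)) none g c S
        (single E.tm.k₀ ((r.reverse.flatMap letterBits).map E.inputAlphabet.symm ++ t))
        [] b' d d') := by
  induction r with
  | nil => intro x t; refine .single ?_; simp
  | cons a r ih =>
    intro x t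
    refine .head (b := config (some (.put a)) (some (some a)) g c S (single E.tm.k₀ t)
      (r.map some) b' d d') ?_ (.head (b := config (some .encode) (some (some a)) g c S
        (single E.tm.k₀ ((letterBits a).map E.inputAlphabet.symm ++ t)) (r.map some) b' d d') ?_ ?_)
    · simp
    · simp [stepAux_pushList]
    · simpa using ih (some (some a)) ((letterBits a).map E.inputAlphabet.symm ++ t)

theorem steps_decode_bits (i : ℕ) (t : List (E.tm.Γ E.tm.k₁)) :
    ∀ j g, ∃ g', Steps (TM2.step (program M E w)) i
      (config (some .decode) x g (counter A j) S (single E.tm.k₁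
        (List.replicate i (E.outputAlphabet.symm .bit1) ++ t)) b b' d d')
      (config (some .decode) x g' (counter A (j + i)) S (single E.tm.k₁ t) b b' d d') := by
  induction i with
  | zero => intro j g; exact ⟨g, rfl⟩
  | succ i ih =>
    intro j g
    obtain ⟨g', h⟩ := ih (j + 1) (some .bit1)
    refine ⟨g', .head ?_ (by rw [← add_assoc, add_right_comm]; exact h)⟩
    simp [List.replicate_succ, counter_add_one]

theorem steps_decode (s : List A) (t : List (E.tm.Γ E.tm.k₁)) :
    ∀ g d d', ∃ g', Steps (TM2.step (program M E w)) (s.flatMap letterBits).length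
      (config (some .decode) x g (counter A 0) S (single E.tm.k₁
        ((s.flatMap letterBits).map E.outputAlphabet.symm ++ t)) b b' d d')
      (config (some .decode) x g' (counter A 0) S (single E.tm.k₁ t) b b'
        (s.reverse.map some ++ d) (s.reverse.map some ++ d')) := by
  induction s with
  | nil => intro g d d'; exact ⟨g, rfl⟩
  | cons a s ih =>
    intro g d d'
    obtain ⟨g₁, h₁⟩ := steps_decode_bits (M := M) (E := E) (w := w) (x := x) (S := S) (b := b)
      (b' := b') (d := d) (d' := d') (letterIdx a) (E.outputAlphabet.symm .bit0 ::
        ((s.flatMap letterBits).map E.outputAlphabet.symm ++ t)) 0 g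
    obtain ⟨g₂, h₂⟩ := ih (some .bit0) (some a :: d) (some a :: d')
    refine ⟨g₂, ?_⟩
    have h := h₁.trans (.head ?_ h₂)
    · simpa [letterBits, add_assoc, add_comm, add_left_comm] using h
    · simp [letterAt_letterIdx]

theorem steps_decode_yes (s : List A) (y : List (M.tm.Γ M.tm.k₀)) :
    Steps (TM2.step (program M E w)) (wordBits s).length
      (config (some .decode) x g (counter A 0) (single M.tm.k₀ y) (single E.tm.k₁
        ((wordBits s).map E.outputAlphabet.symm)) b b' [] [])
      (config (some .feedRes) x (some .cons) (counter A 1)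
        (single M.tm.k₀ (M.inputAlphabet.symm none :: y)) (fun _ => []) b b'
        (s.reverse.map some) (s.reverse.map some)) := by
  obtain ⟨g', h⟩ := steps_decode (M := M) (E := E) (w := w) (x := x) (S := single M.tm.k₀ y)
    (b := b) (b' := b') s ([.bit1, .cons].map E.outputAlphabet.symm) g [] []
  have h' := h.trans (.head (b := config (some .decode) x (some .bit1) (counter A 1)
    (single M.tm.k₀ y) (single E.tm.k₁ ([.cons].map E.outputAlphabet.symm)) b b'
    (s.reverse.map some) (s.reverse.map some)) ?_ (.single (b :=
      config (some .feedRes) x (some .cons) (counter A 1)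
        (single M.tm.k₀ (M.inputAlphabet.symm none :: y)) (fun _ => []) b b'
        (s.reverse.map some) (s.reverse.map some)) ?_))
  · simpa [wordBits] using h'
  · simp [counter_add_one]
  · simp

theorem steps_decode_no :
    Steps (TM2.step (program M E w)) 1
      (config (some .decode) x g (counter A 0) S (single E.tm.k₁
        ([.cons].map E.outputAlphabet.symm)) b b' d d')
      (config (some .clear) x (some .cons) (counter A 0) S (fun _ => []) b b' d d') := by
  -- The summand 2 in the size of the counter keeps 0 and 1 distinct even for an empty alphabet.
  have h : counter A 0 ≠ counter A 1 := by
    simp [counter, Fin.ext_iff]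
  refine .single ?_
  simp [h]

theorem steps_feedRes (r : List A) :
    ∀ x y, Steps (TM2.step (program M E w)) (r.length + 1)
      (config (some .feedRes) x g c (single M.tm.k₀ y) T b b' (r.map some) d')
      (config (some .feedArg) none g c (single M.tm.k₀ (M.inputAlphabet.symm none ::
        (r.reverse.map (fun a => M.inputAlphabet.symm (some a)) ++ y))) T b b' [] d') := by
  induction r with
  | nil => intro x y; refine .single ?_; simp
  | cons a r ih =>
    intro x y
    refine .head ?_ (by simpa using ih (some (some a)) (M.inputAlphabet.symm (some a) :: y))
    simp

theorem steps_feedArg (r : List A) :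
    ∀ x y, Steps (TM2.step (program M E w)) (r.length + 1)
      (config (some .feedArg) x g c (single M.tm.k₀ y) T b (r.map some) d d')
      (config (some (.runM M.tm.main)) none g c (single M.tm.k₀
        (r.reverse.map (fun a => M.inputAlphabet.symm (some a)) ++ y)) T b [] d d') := by
  induction r with
  | nil => intro x y; refine .single ?_; simp
  | cons a r ih =>
    intro x y
    refine .head ?_ (by simpa using ih (some (some a)) (M.inputAlphabet.symm (some a) :: y))
    simp

theorem steps_mark (y : List (M.tm.Γ M.tm.k₁)) :
    Steps (TM2.step (program M E w)) 1
      (config (some .mark) x g c (single M.tm.k₁ y) T b b' d d')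
      (config (some .emit) x g c (single M.tm.k₁ (M.outputAlphabet.symm none :: y))
        T b b' d d') := by
  refine .single ?_
  simp

theorem steps_emit (r : List A) :
    ∀ x y, Steps (TM2.step (program M E w)) (r.length + 1)
      (config (some .emit) x g c (single M.tm.k₁ y) T b b' d (r.map some))
      (config none none none (counter A 0) (single M.tm.k₁
        (r.reverse.map (fun a => M.outputAlphabet.symm (some a)) ++ y)) T b b' d []) := by
  induction r with
  | nil => intro x y; refine .single ?_; simp
  | cons a r ih =>
    intro x y
    refine .head ?_ (by simpa using ih (some (some a)) (M.outputAlphabet.symm (some a) :: y))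
    simp

theorem steps_clear (y : List (M.tm.Γ M.tm.k₀)) :
    ∀ x, Steps (TM2.step (program M E w)) (y.length + 1)
      (config (some .clear) x g c (single M.tm.k₀ y) T b b' d d')
      (config (some .clearArg) none g c (fun _ => []) T b b' d d') := by
  induction y with
  | nil => intro x; refine .single ?_; simp
  | cons a y ih =>
    intro x
    refine .head ?_ (ih (some (M.inputAlphabet a)))
    simp

theorem steps_clearArg (r : List (Option A)) :
    ∀ x, Steps (TM2.step (program M E w)) (r.length + 1)
      (config (some .clearArg) x g c (fun _ => []) T b r d d')
      (config none none none (counter A 0) (single M.tm.k₁ (w.map M.outputAlphabet.symm))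
        T b [] d d') := by
  induction r with
  | nil => intro x; refine .single ?_; simp [stepAux_pushList]
  | cons a r ih =>
    intro x
    refine .head ?_ (ih (some a))
    simp

/-- `E` halts in its initial state with only its output stack filled, so the lifted run ends in a
`config` again, with the halt replaced by a jump to `decode`. -/
theorem steps_runE {n : ℕ} {l : List (E.tm.Γ E.tm.k₀)} {l' : List (E.tm.Γ E.tm.k₁)}
    (h : Steps (TM2.step E.tm.m) n (initList E.tm l) (haltList E.tm l')) :
    Steps (TM2.step (program M E w)) n
      (config (some (.runE E.tm.main)) x g c S (single E.tm.k₀ l) b b' d d')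
      (config (some .decode) x g c S (single E.tm.k₁ l') b b' d d') := by
  rw [initList_eq, haltList_eq] at h
  obtain ⟨⟨m, v, S'⟩, hc, hl, hv, hS, hr⟩ := represents_steps (Γ := stackAlphabet M E)
    (ι := fun k => .inr (.inl k)) (get := fun v : Register M E => v.2.1)
    (put := fun a v => (v.1, a, v.2.2)) (lab := Label.runE) (exit := some .decode)
    (m₁ := E.tm.m) (m₂ := program M E w) (v₀ := register M E x g c)
    (S₀ := stackVal S (fun _ => []) b b' d d')
    (fun _ _ h => by simpa using h) (fun _ _ => rfl) (fun _ _ _ => rfl) (fun _ => True)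
    (fun _ _ _ _ _ _ => trivial) (fun _ _ => rfl) h
    (c₂ := config (some (.runE E.tm.main)) x g c S (single E.tm.k₀ l) b b' d d')
    (fun _ _ => trivial) (by
      refine ⟨rfl, rfl, fun k => rfl, ?_⟩
      rintro (k | k | k | k | k | k) hk
      any_goals rfl
      exact (hk ⟨k, rfl⟩).elim)
  dsimp only [Option.elim] at hl hv hS hr
  subst hl hv
  have e : S' = stackVal S (single E.tm.k₁ l') b b' d d' := by
    funext k
    obtain k | k | k | k | k | k := k
    case inr.inl => exact hS k
    all_goals exact hr _ (by rintro ⟨k', hk'⟩; simp at hk')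
  subst e
  exact hc

theorem steps_runM {n : ℕ} {l : List (M.tm.Γ M.tm.k₀)} {l' : List (M.tm.Γ M.tm.k₁)}
    (h : Steps (TM2.step M.tm.m) n (initList M.tm l) (haltList M.tm l')) :
    Steps (TM2.step (program M E w)) n
      (config (some (.runM M.tm.main)) x g c (single M.tm.k₀ l) T b b' d d')
      (config (some .mark) x g c (single M.tm.k₁ l') T b b' d d') := by
  rw [initList_eq, haltList_eq] at h
  obtain ⟨⟨m, v, S'⟩, hc, hl, hv, hS, hr⟩ := represents_steps (Γ := stackAlphabet M E)
    (ι := fun k => .inl k) (get := fun v : Register M E => v.1)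
    (put := fun a v => (a, v.2)) (lab := Label.runM) (exit := some .mark)
    (m₁ := M.tm.m) (m₂ := program M E w) (v₀ := register M E x g c)
    (S₀ := stackVal (fun _ => []) T b b' d d')
    (fun _ _ h => by simpa using h) (fun _ _ => rfl) (fun _ _ _ => rfl) (fun _ => True)
    (fun _ _ _ _ _ _ => trivial) (fun _ _ => rfl) h
    (c₂ := config (some (.runM M.tm.main)) x g c (single M.tm.k₀ l) T b b' d d')
    (fun _ _ => trivial) (by
      refine ⟨rfl, rfl, fun k => rfl, ?_⟩
      rintro (k | k | k | k | k | k) hk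
      any_goals rfl
      exact (hk ⟨k, rfl⟩).elim)
  dsimp only [Option.elim] at hl hv hS hr
  subst hl hv
  have e : S' = stackVal (single M.tm.k₁ l') T b b' d d' := by
    funext k
    obtain k | k | k | k | k | k := k
    case inl => exact hS k
    all_goals exact hr _ (by rintro ⟨k', hk'⟩; simp at hk')
  subst e
  exact hc

theorem combined_initList (l : List (M.tm.Γ M.tm.k₀)) :
    initList (combined M E w).tm l =
      config (some .scan) none none (counter A 0) (single M.tm.k₀ l) (fun _ => []) [] [] [] [] := by
  refine (initList_eq (combined M E w).tm l).trans ?_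
  refine (TM2.Cfg.mk.injEq ..).mpr ⟨rfl, rfl, ?_⟩
  rw [← update_nil, ← update_stackVal_inl, stackVal_nil]
  rfl

theorem combined_haltList (l : List (M.tm.Γ M.tm.k₁)) :
    haltList (combined M E w).tm l =
      config none none none (counter A 0) (single M.tm.k₁ l) (fun _ => []) [] [] [] [] := by
  refine (haltList_eq (combined M E w).tm l).trans ?_
  refine (TM2.Cfg.mk.injEq ..).mpr ⟨rfl, rfl, ?_⟩
  rw [← update_nil, ← update_stackVal_inl, stackVal_nil]
  rfl

theorem combined_computesWithin_of_steps {α β : Type} [WordCoding A α] [WordCoding A β] {x : α}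
    {y : β} {n t : ℕ} (hn : n ≤ t) (h : Steps (TM2.step (program M E w)) n
      (config (some .scan) none none (counter A 0)
        (single M.tm.k₀ ((WordCoding.code x).map M.inputAlphabet.symm)) (fun _ => []) [] [] [] [])
      (config none none none (counter A 0)
        (single M.tm.k₁ ((WordCoding.code y).map M.outputAlphabet.symm))
        (fun _ => []) [] [] [] [])) :
    (combined M E w).ComputesWithin x y t := by
  refine outputsInTime_iff.2 ⟨n, hn, ?_⟩
  rw [← combined_initList (E := E) (w := w), ← combined_haltList (E := E) (w := w)] at h
  exact h

end Machine

theorem map_code_pair {A B α : Type} [WordCoding A α] (f : Option A → B) (s : List A) (y : α) :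
    (WordCoding.code (s, y)).map f =
      s.map (fun a => f (some a)) ++ f none :: (WordCoding.code y).map f := by
  simp [WordCoding.code, Function.comp_def]

section Machine

variable {A : Type} [Fintype A] {M : Algorithm A} {E : TM2ComputableAux Γ' Γ'}

/-- The first part of the computation, up to the result of `E`. -/
theorem steps_combined_decode (w : List (Option A)) (s y : List A) {n : ℕ}
    {l : List (E.tm.Γ E.tm.k₁)}
    (h : Steps (TM2.step E.tm.m) n (initList E.tm ((wordBits s).map E.inputAlphabet.symm))
      (haltList E.tm l)) :
    Steps (TM2.step (program M E w)) (s.length + 1 + (2 * s.length + 1 + n))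
      (config (some .scan) none none (counter A 0)
        (single M.tm.k₀ ((WordCoding.code (s, y)).map M.inputAlphabet.symm)) (fun _ => [])
        [] [] [] [])
      (config (some .decode) none none (counter A 0)
        (single M.tm.k₀ ((WordCoding.code y).map M.inputAlphabet.symm))
        (single E.tm.k₁ l) [] (s.reverse.map some) [] []) := by
  rw [map_code_pair]
  have h₁ := steps_scan (M := M) (E := E) (w := w) (g := none) (c := counter A 0) (d := [])
    (d' := []) s ((WordCoding.code y).map M.inputAlphabet.symm) none [] []
  have h₂ := steps_encode (M := M) (E := E) (w := w) (g := none) (c := counter A 0) (d := [])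
    (d' := []) (S := single M.tm.k₀ ((WordCoding.code y).map M.inputAlphabet.symm))
    (b' := s.reverse.map some) s.reverse (some none) ([.bit1, .cons].map E.inputAlphabet.symm)
  rw [List.reverse_reverse, List.length_reverse, ← List.map_append] at h₂
  rw [List.append_nil] at h₁
  exact h₁.trans (h₂.trans (steps_runE h))

/-- The combined machine returns the fixed word if `E` returns the code of zero. -/
theorem combined_computesWithin_const (p : List A × List A) (s y : List A) {t : ℕ}
    (h : Nonempty (TM2OutputsInTime E.tm ((wordBits s).map E.inputAlphabet.symm)
      (some ([.cons].map E.outputAlphabet.symm)) t)) :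
    (combined M E (WordCoding.code p)).ComputesWithin (s, y) p
      (t + (4 * s.length + y.length + 5)) := by
  obtain ⟨n, hn, h⟩ := outputsInTime_iff.1 h
  have h₁ := steps_combined_decode (M := M) (WordCoding.code p) s y h
  have h₂ := h₁.trans (steps_decode_no.trans ((steps_clear _ _).trans (steps_clearArg _ _)))
  refine combined_computesWithin_of_steps ?_ h₂
  simp only [List.length_map, List.length_reverse]
  rw [show (WordCoding.code y : List (Option A)).length = y.length from List.length_map _]
  omega

/-- The combined machine computes `(s', z)` if `E` computes `s'` from `s` and `M` computes `z` from
`(s, s', y)`. -/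
theorem combined_computesWithin (w : List (Option A)) (s s' y z : List A) {t t' : ℕ}
    (h : Nonempty (TM2OutputsInTime E.tm ((wordBits s).map E.inputAlphabet.symm)
      (some ((wordBits s').map E.outputAlphabet.symm)) t))
    (h' : M.ComputesWithin (s, s', y) z t') :
    (combined M E w).ComputesWithin (s, y) (s', z)
      (t + t' + (4 * s.length + 2 * s'.length + (wordBits s').length + 6)) := by
  obtain ⟨n, hn, h⟩ := outputsInTime_iff.1 h
  obtain ⟨n', hn', h'⟩ := outputsInTime_iff.1 h'
  have h₁ := steps_combined_decode (M := M) w s y h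
  have h₂ := h₁.trans ((steps_decode_yes _ _).trans ((steps_feedRes _ _ _).trans
    (steps_feedArg _ _ _)))
  rw [List.reverse_reverse, List.reverse_reverse, ← map_code_pair M.inputAlphabet.symm,
    ← map_code_pair M.inputAlphabet.symm] at h₂
  have h₃ := h₂.trans ((steps_runM h').trans ((steps_mark _).trans (steps_emit _ _ _)))
  rw [List.reverse_reverse, ← map_code_pair M.outputAlphabet.symm] at h₃
  refine combined_computesWithin_of_steps ?_ h₃
  simp only [List.length_reverse]
  omega

end Machine

/-! ### Words as numbers -/

section WordNum

variable {A : Type} [Fintype A]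

/-- The positive number whose binary digits code a word. -/
noncomputable def wordPosNum (s : List A) : PosNum :=
  s.foldr (fun a p => PosNum.bit1^[letterIdx a] p.bit0) 1

/-- The number whose binary digits code a word. -/
noncomputable def wordNum (s : List A) : ℕ :=
  wordPosNum s

theorem trList_singleton (n : ℕ) : trList [n] = trNat n ++ [.cons] := by
  simp [trList]

theorem trList_zero : trList [0] = [.cons] := by
  simp [trList]

/-- Bits are listed from the least significant one, so each letter contributes a leading block, and
the top digit 1 of the numeral closes the word. -/
theorem trPosNum_wordPosNum (s : List A) :
    trPosNum (wordPosNum s) = s.flatMap letterBits ++ [.bit1] := by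
  induction s with
  | nil => rfl
  | cons a s ih =>
    have key : ∀ (i : ℕ) (p : PosNum), trPosNum (PosNum.bit1^[i] p) =
        List.replicate i .bit1 ++ trPosNum p := by
      intro i p
      induction i with
      | zero => rfl
      | succ i ih => rw [Function.iterate_succ_apply', trPosNum, ih]; rfl
    have h : wordPosNum (a :: s) = PosNum.bit1^[letterIdx a] (wordPosNum s).bit0 := rfl
    rw [h, key, trPosNum, ih]
    simp [letterBits]

theorem trList_wordNum (s : List A) : trList [wordNum s] = wordBits s := by
  have h : trNat (wordNum s) = trPosNum (wordPosNum s) := by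
    rw [trNat, wordNum, PosNum.of_to_nat]
    rfl
  rw [trList_singleton, h, trPosNum_wordPosNum]
  simp [wordBits]

/-- The blocks `1…10` form a prefix code. -/
theorem iterate_bit1_injective {i j : ℕ} {p q : PosNum}
    (h : PosNum.bit1^[i] p.bit0 = PosNum.bit1^[j] q.bit0) : i = j ∧ p = q := by
  induction i generalizing j with
  | zero =>
    cases j with
    | zero => exact ⟨rfl, PosNum.bit0.inj h⟩
    | succ j => rw [Function.iterate_succ_apply'] at h; cases h
  | succ i ih =>
    rw [Function.iterate_succ_apply'] at h
    cases j with
    | zero => cases h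
    | succ j =>
      rw [Function.iterate_succ_apply'] at h
      obtain ⟨rfl, rfl⟩ := ih (PosNum.bit1.inj h)
      exact ⟨rfl, rfl⟩

theorem iterate_bit1_ne_one (i : ℕ) (p : PosNum) : PosNum.bit1^[i] p.bit0 ≠ 1 := by
  cases i with
  | zero => exact fun h => by cases h
  | succ i => rw [Function.iterate_succ_apply']; exact fun h => by cases h

theorem wordPosNum_injective : Function.Injective (wordPosNum (A := A)) := by
  intro s s' h
  induction s generalizing s' with
  | nil =>
    cases s' with
    | nil => rfl
    | cons a' s' => exact (iterate_bit1_ne_one _ _ h.symm).elim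
  | cons a s ih =>
    cases s' with
    | nil => exact (iterate_bit1_ne_one _ _ h).elim
    | cons a' s' =>
      obtain ⟨h₁, h₂⟩ := iterate_bit1_injective h
      have : a = a' := (Fintype.equivFin A).injective (Fin.ext h₁)
      rw [this, ih h₂]

theorem wordNum_injective : Function.Injective (wordNum (A := A)) := fun _ _ h =>
  wordPosNum_injective (PosNum.cast_inj.1 h)

/-- Rewrites the coding in `ℕ`, in the form of a recursion visibly primitive recursive. -/
theorem wordNum_eq_foldr (s : List A) :
    wordNum s = s.foldr (fun a n => (fun m => 2 * m + 1)^[letterIdx a] (2 * n)) 1 := by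
  induction s with
  | nil => rfl
  | cons a s ih =>
    have key : ∀ (i : ℕ) (p : PosNum), ((PosNum.bit1^[i] p : PosNum) : ℕ) =
        (fun m => 2 * m + 1)^[i] (p : ℕ) := by
      intro i p
      induction i with
      | zero => rfl
      | succ i ih =>
        rw [Function.iterate_succ_apply', Function.iterate_succ_apply', PosNum.cast_bit1, ih]
        ring
    have h : wordPosNum (a :: s) = PosNum.bit1^[letterIdx a] (wordPosNum s).bit0 := rfl
    rw [wordNum, h, key, List.foldr_cons, ← ih, PosNum.cast_bit0, two_mul]
    rfl

variable [Primcodable A]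

theorem primrec_wordNum : Primrec (wordNum (A := A)) := by
  have h : Primrec₂ fun (_ : List A) (p : A × ℕ) =>
      (fun m => 2 * m + 1)^[letterIdx p.1] (2 * p.2) := by
    refine (Primrec.nat_iterate (α := List A × A × ℕ) (f := fun q => letterIdx q.2.1)
      (g := fun q => 2 * q.2.2) (h := fun _ m => 2 * m + 1) ?_ ?_ ?_).to₂
    · exact (Primrec.dom_finite letterIdx).comp (Primrec.fst.comp Primrec.snd)
    · exact Primrec.nat_double.comp (Primrec.snd.comp Primrec.snd)
    · exact (Primrec.nat_double_succ.comp Primrec.snd).to₂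
  refine (Primrec.list_foldr Primrec.id (Primrec.const 1) h).of_eq fun s => ?_
  exact (wordNum_eq_foldr s).symm

theorem primrec_wordBits : Primrec (wordBits (A := A)) :=
  Primrec.list_append.comp (Primrec.list_flatMap Primrec.id
    ((Primrec.dom_finite letterBits).comp Primrec.snd).to₂) (Primrec.const _)

end WordNum

/-! ### Computable maps on words and computable selection -/

theorem computable_get {α β : Type} [Primcodable α] [Primcodable β] {f : α →. β} (hf : Partrec f)
    (h : ∀ a, (f a).Dom) : Computable fun a => (f a).get (h a) :=
  Partrec.of_eq hf fun a => (Part.some_get (h a)).symm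

/-- Every computable partial map on words is computed by a machine on the binary codes, with a
computable bound on the running time. -/
theorem exists_machine_of_computable {A : Type} [Fintype A] [Primcodable A]
    {e : List A → Option (List A)} (he : Computable e) :
    ∃ (E : TM2ComputableAux Γ' Γ') (T : List A → ℕ), Computable T ∧ ∀ s,
      Nonempty (TM2OutputsInTime E.tm ((wordBits s).map E.inputAlphabet.symm)
        (some (((e s).elim [.cons] wordBits).map E.outputAlphabet.symm)) (T s)) := by
  classical
  -- The word coded by `n` is recovered by brute force; this is harmless because the running time
  -- need only be computable. Injectivity of `wordNum` makes the result right.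
  let search : ℕ → ℕ → Option (List A) := fun n k =>
    (Encodable.decode k : Option (List A)).bind fun s =>
      if wordNum s = n then some s else none
  have hsearch : Computable₂ search := by
    refine Primrec.to_comp (Primrec.option_bind (Primrec.decode.comp Primrec.snd) ?_)
    refine (Primrec.ite (Primrec.eq.comp (primrec_wordNum.comp Primrec.snd)
      (Primrec.fst.comp Primrec.fst)) (Primrec.option_some.comp Primrec.snd)
      (Primrec.const none)).to₂
  -- Word codes are positive, so 0 is free to stand for an undefined value.
  let f : ℕ →. ℕ := fun n =>
    (Nat.rfindOpt (search n)).map fun s => (e s).elim 0 wordNum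
  have hf : Partrec f := by
    have h : Computable fun s => (e s).elim 0 wordNum := by
      refine (Computable.option_casesOn he (Computable.const 0)
        (primrec_wordNum.to_comp.comp Computable.snd).to₂).of_eq fun s => ?_
      cases e s <;> rfl
    exact (Partrec.rfindOpt hsearch).map (h.comp Computable.snd).to₂
  have hval : ∀ s, (e s).elim 0 wordNum ∈ f (wordNum s) := by
    intro s
    refine Part.mem_map_iff _ |>.2 ⟨s, ?_, rfl⟩
    have hd : (Nat.rfindOpt (search (wordNum s))).Dom :=
      Nat.rfindOpt_dom.2 ⟨Encodable.encode s, s, by simp [search]⟩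
    obtain ⟨k, hk⟩ := Nat.rfindOpt_spec (Part.get_mem hd)
    simp only [search, Option.mem_def, Option.bind_eq_some_iff] at hk
    obtain ⟨s', -, hs'⟩ := hk
    split_ifs at hs' with h
    have e₁ := wordNum_injective h
    have e₂ := Option.some.inj hs'
    have e₃ : s = (Nat.rfindOpt (search (wordNum s))).get hd := e₁.symm.trans e₂
    exact (congrArg (· ∈ Nat.rfindOpt (search (wordNum s))) e₃).mpr (Part.get_mem hd)
  obtain ⟨E, T, hT, hE⟩ := exists_machine_of_partrec hf
  have hE' : ∀ s, ∃ t ∈ T (wordBits s), Nonempty (TM2OutputsInTime E.tm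
      ((wordBits s).map E.inputAlphabet.symm)
      (some (((e s).elim [.cons] wordBits).map E.outputAlphabet.symm)) t) := by
    intro s
    have := hE _ _ (hval s)
    rw [trList_wordNum] at this
    cases h : e s with
    | none => rwa [h, Option.elim, trList_zero] at this
    | some s' => rwa [h, Option.elim, trList_wordNum] at this
  have hdom : ∀ s : List A, (T (wordBits s)).Dom := fun s =>
    Part.dom_iff_mem.2 ⟨_, (hE' s).choose_spec.1⟩
  refine ⟨E, fun s => (T (wordBits s)).get (hdom s),
    computable_get (hT.comp primrec_wordBits.to_comp) hdom, fun s => ?_⟩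
  obtain ⟨t, ht, h⟩ := hE' s
  have e₁ : t = (T (wordBits s)).get (hdom s) := (Part.get_eq_of_mem ht _).symm
  subst e₁
  exact h

/-- Computable selection: from `a` satisfying the decidable predicate `p` one can compute some `b`
satisfying the decidable predicate `q` and such that `(a, b)` is in the recursively enumerable
relation `R`, provided that there always is one. -/
theorem exists_computable_selection {α β : Type} [Primcodable α] [Primcodable β] {p : α → Prop}
    {q : β → Prop} {R : α × β → Prop} (hp : ComputablePred p) (hq : ComputablePred q)
    (hR : REPred R) (h : ∀ a, p a → ∃ b, q b ∧ R (a, b)) :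
    ∃ e : α → Option β, Computable e ∧ (∀ a b, e a = some b → p a ∧ q b ∧ R (a, b)) ∧
      ∀ a, p a → e a ≠ none := by
  obtain ⟨_, hp⟩ := hp
  obtain ⟨_, hq⟩ := hq
  obtain ⟨c, hc⟩ := Nat.Partrec.Code.exists_code.1 hR
  have hc' : ∀ x, R x ↔ ∃ k, (Nat.Partrec.Code.evaln k c (Encodable.encode x)).isSome := by
    intro x
    have h₁ : (Nat.Partrec.Code.eval c (Encodable.encode x)).Dom ↔ R x := by
      rw [hc]
      simp [Part.assert]
    rw [← h₁, Part.dom_iff_mem]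
    constructor
    · rintro ⟨y, hy⟩
      obtain ⟨k, hk⟩ := Nat.Partrec.Code.evaln_complete.1 hy
      exact ⟨k, by rw [Option.mem_def.1 hk]; rfl⟩
    · rintro ⟨k, hk⟩
      obtain ⟨y, hy⟩ := Option.isSome_iff_exists.1 hk
      exact ⟨y, Nat.Partrec.Code.evaln_complete.2 ⟨k, hy⟩⟩
  -- Dovetailing: `n` encodes a candidate `b` and a bound on the steps spent on confirming `R (a,
  -- b)`.
  let search : α → ℕ → Option β := fun a n =>
    (Encodable.decode n.unpair.1 : Option β).bind fun b =>
      bif decide (q b) && (Nat.Partrec.Code.evaln n.unpair.2 c (Encodable.encode (a, b))).isSome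
        then some b else none
  have hsearch : Computable₂ search := by
    have h₀ : Computable fun y : (ℕ × Nat.Partrec.Code) × ℕ =>
        (Nat.Partrec.Code.evaln y.1.1 y.1.2 y.2).isSome :=
      (Primrec.option_isSome.comp Nat.Partrec.Code.primrec_evaln).to_comp
    have h₁ : Computable fun x : (α × ℕ) × β =>
        ((x.1.2.unpair.2, c), Encodable.encode (x.1.1, x.2)) :=
      ((Computable.snd.comp (Computable.unpair.comp (Computable.snd.comp Computable.fst))).pair
        (Computable.const c)).pair (Computable.encode.comp
          ((Computable.fst.comp Computable.fst).pair Computable.snd))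
    have h₂ := h₀.comp h₁
    have h₃ : Computable fun x : (α × ℕ) × β => decide (q x.2) := hq.comp Computable.snd
    have h₄ := Primrec.and.to_comp.comp h₃ h₂
    have h₅ := Computable.cond h₄ (Computable.option_some.comp Computable.snd)
      (Computable.const none)
    exact Computable.option_bind (Computable.decode.comp
      (Computable.fst.comp (Computable.unpair.comp Computable.snd))) h₅.to₂
  have hspec : ∀ a b, b ∈ Nat.rfindOpt (search a) → q b ∧ R (a, b) := by
    intro a b hb
    obtain ⟨n, hn⟩ := Nat.rfindOpt_spec hb
    simp only [search, Option.mem_def, Option.bind_eq_some_iff] at hn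
    obtain ⟨b', -, hb'⟩ := hn
    cases ht : (decide (q b') &&
        (Nat.Partrec.Code.evaln n.unpair.2 c (Encodable.encode (a, b'))).isSome) with
    | false => rw [ht] at hb'; simp at hb'
    | true =>
      simp only [ht, cond_true, Option.some.injEq] at hb'
      subst hb'
      simp only [Bool.and_eq_true, decide_eq_true_eq] at ht
      exact ⟨ht.1, (hc' _).2 ⟨_, ht.2⟩⟩
  -- Deciding `p a` beforehand makes `g` total: the search runs only where it must succeed.
  let g : α →. Option β := fun a =>
    bif decide (p a) then (Nat.rfindOpt (search a)).map some else Part.some none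
  have hg : Partrec g := Partrec.cond hp
    ((Partrec.rfindOpt hsearch).map (Computable.option_some.comp Computable.snd).to₂)
    (Computable.const none).partrec
  have hdom : ∀ a, (g a).Dom := by
    intro a
    by_cases ha : p a
    · obtain ⟨b, hb, hR⟩ := h a ha
      obtain ⟨k, hk⟩ := (hc' _).1 hR
      simp only [g, ha, decide_true, cond_true, Part.map_Dom]
      exact Nat.rfindOpt_dom.2 ⟨Nat.pair (Encodable.encode b) k, b, by
        rw [Encodable.encode_prod_val] at hk
        simp [search, hb, hk]⟩
    · simp [g, ha]
  refine ⟨fun a => (g a).get (hdom a), computable_get hg hdom, fun a b hab => ?_, fun a ha => ?_⟩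
  · have hm : some b ∈ g a := hab ▸ Part.get_mem (hdom a)
    by_cases ha : p a
    · simp only [g, ha, decide_true, cond_true, Part.mem_map_iff, Option.some.injEq,
        exists_eq_right] at hm
      exact ⟨ha, hspec a b hm⟩
    · simp [g, ha] at hm
  · intro hab
    have hm : none ∈ g a := hab ▸ Part.get_mem (hdom a)
    simp [g, ha] at hm

/-! ### Time bounds -/

theorem eval_le_eval_one_mul_pow (p : Polynomial ℕ) (m : ℕ) :
    p.eval m ≤ p.eval 1 * (m + 1) ^ p.natDegree := by
  rw [Polynomial.eval_eq_sum_range, Polynomial.eval_eq_sum_range, Finset.sum_mul]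
  refine Finset.sum_le_sum fun i hi => ?_
  rw [one_pow, mul_one]
  refine Nat.mul_le_mul_left _ ((Nat.pow_le_pow_left (Nat.le_succ m) i).trans ?_)
  exact Nat.pow_le_pow_right (Nat.succ_pos m) (Nat.lt_succ_iff.1 (Finset.mem_range.1 hi))

/-- Since `m + n + 1 ≤ (n + 1) * (m + 1)`, the bound splits into a factor for the parameter and one
for the instance. -/
theorem eval_add_le (p : Polynomial ℕ) (m n : ℕ) :
    p.eval (m + n) ≤ p.eval 1 * (n + 1) ^ p.natDegree * (m + 1) ^ p.natDegree := by
  refine (eval_le_eval_one_mul_pow p _).trans ?_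
  rw [mul_assoc, ← mul_pow]
  refine Nat.mul_le_mul_left _ (Nat.pow_le_pow_left ?_ _)
  nlinarith [Nat.zero_le (m * n)]

theorem primrec_pow_const (d : ℕ) : Primrec fun n : ℕ => n ^ d := by
  induction d with
  | zero => exact (Primrec.const 1).of_eq fun n => (pow_zero n).symm
  | succ d ih => exact (Primrec.nat_mul.comp ih .id).of_eq fun n => (pow_succ n d).symm

theorem size_list {A : Type} (y : List A) : size A y = y.length :=
  List.length_map _

theorem size_pair {A α : Type} [WordCoding A α] (s : List A) (y : α) :
    size A (s, y) = s.length + size A y + 1 := by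
  simp [size, WordCoding.code]
  omega

theorem Algorithm.ComputesWithin.mono {A α β : Type} [WordCoding A α] [WordCoding A β]
    {M : Algorithm A} {x : α} {y : β} {t t' : ℕ} (h : M.ComputesWithin x y t) (ht : t ≤ t') :
    M.ComputesWithin x y t' :=
  h.map fun h => ⟨h.toEvalsTo, h.steps_le_m.trans ht⟩

/-- A machine which first computes a new parameter `s'` from `s` by the computable function `e`, then
applies `M` to `(s, s', y)`, and returns `p₀` if `e` is undefined at `s`. -/
theorem exists_combined_machine {A : Type} [Fintype A] [Primcodable A]
    {r : List A × List A × List A →. List A} {M : Algorithm A} {f : List A × List A → ℕ}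
    {p : Polynomial ℕ}
    (hM : ∀ x, ∀ z ∈ r x, M.ComputesWithin x z (f (x.1, x.2.1) * p.eval (size A x)))
    (p₀ : List A × List A) {e : List A → Option (List A)} (he : Computable e) :
    ∃ (N : Algorithm A) (F : List A → ℕ), (Computable f → Computable F) ∧
      (∀ s y : List A, e s = none → N.ComputesWithin (s, y) p₀
        (F s * (size A (s, y) + 1) ^ (p.natDegree + 1))) ∧
      ∀ s y s' z : List A, e s = some s' → z ∈ r (s, s', y) → N.ComputesWithin (s, y) (s', z)
        (F s * (size A (s, y) + 1) ^ (p.natDegree + 1)) := by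
  obtain ⟨E, T, hT, hE⟩ := exists_machine_of_computable he
  -- Inserting `s'` lengthens the input of `M` by `s'.length + 1`; `eval_add_le` with this increment
  -- yields the base `s'.length + 2`.
  let G : List A → List A → ℕ := fun s s' =>
    f (s, s') * (p.eval 1 * (s'.length + 2) ^ p.natDegree) + 2 * s'.length + (wordBits s').length
  let F : List A → ℕ := fun s => T s + 4 * s.length + 6 + (e s).elim 0 (G s)
  refine ⟨combined M E (WordCoding.code p₀), F, fun hf => ?_, fun s y h => ?_,
    fun s y s' z h hz => ?_⟩
  · have h₁ : Computable₂ G := by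
      have h₂ : Computable fun x : List A × List A => f (x.1, x.2) := hf
      have h₃ : Primrec fun x : List A × List A =>
          p.eval 1 * (x.2.length + 2) ^ p.natDegree :=
        Primrec.nat_mul.comp (Primrec.const _) ((primrec_pow_const _).comp
          (Primrec.nat_add.comp (Primrec.list_length.comp Primrec.snd) (Primrec.const 2)))
      have h₄ : Primrec fun x : List A × List A => 2 * x.2.length :=
        Primrec.nat_double.comp (Primrec.list_length.comp Primrec.snd)
      have h₅ : Primrec fun x : List A × List A => (wordBits x.2).length :=
        Primrec.list_length.comp (primrec_wordBits.comp Primrec.snd)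
      exact (Primrec.nat_add.to_comp.comp (Primrec.nat_add.to_comp.comp
        (Primrec.nat_mul.to_comp.comp h₂ h₃.to_comp) h₄.to_comp) h₅.to_comp).to₂
    have h₂ : Computable fun s => (e s).elim 0 (G s) := by
      refine (Computable.option_casesOn he (Computable.const 0) h₁).of_eq fun s => ?_
      cases e s <;> rfl
    have h₃ : Primrec fun s : List A => 4 * s.length :=
      Primrec.nat_mul.comp (Primrec.const 4) Primrec.list_length
    exact Primrec.nat_add.to_comp.comp (Primrec.nat_add.to_comp.comp
      (Primrec.nat_add.to_comp.comp hT h₃.to_comp) (Computable.const 6)) h₂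
  · have h₁ := combined_computesWithin_const (M := M) p₀ s y
      (by have := hE s; rwa [h] at this)
    refine h₁.mono ?_
    -- The exponent exceeds the degree of `p` by one so that the power dominates linear terms even
    -- if `p` is constant.
    have hP : size A (s, y) + 1 ≤ (size A (s, y) + 1) ^ (p.natDegree + 1) :=
      Nat.le_self_pow (Nat.succ_ne_zero _) _
    have hy : y.length ≤ size A (s, y) := by
      rw [size_pair, size_list]
      omega
    simp only [F, h, Option.elim, add_zero]
    refine le_trans ?_ (Nat.mul_le_mul_left _ hP)
    nlinarith
  · have h₁ := combined_computesWithin (WordCoding.code p₀) s s' y z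
      (by have := hE s; rwa [h] at this) (hM _ z hz)
    refine h₁.mono ?_
    have hP : 1 ≤ (size A (s, y) + 1) ^ (p.natDegree + 1) := Nat.one_le_pow _ _ (Nat.succ_pos _)
    have hP' : (size A (s, y) + 1) ^ p.natDegree ≤ (size A (s, y) + 1) ^ (p.natDegree + 1) :=
      Nat.pow_le_pow_right (Nat.succ_pos _) (Nat.le_succ _)
    have hsize : size A (s, s', y) = size A (s, y) + (s'.length + 1) := by
      simp only [size_pair, size_list]
      omega
    have hp : f (s, s') * p.eval (size A (s, s', y)) ≤
        f (s, s') * (p.eval 1 * (s'.length + 2) ^ p.natDegree) *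
          (size A (s, y) + 1) ^ (p.natDegree + 1) := by
      rw [hsize, mul_assoc]
      exact Nat.mul_le_mul_left _ ((eval_add_le p _ _).trans (Nat.mul_le_mul_left _ hP'))
    simp only [F, G, h, Option.elim]
    have hr := Nat.le_mul_of_pos_right
      (T s + 4 * s.length + 6 + 2 * s'.length + (wordBits s').length) hP
    calc _ ≤ (T s + 4 * s.length + 6 + 2 * s'.length + (wordBits s').length) *
            (size A (s, y) + 1) ^ (p.natDegree + 1) +
          f (s, s') * (p.eval 1 * (s'.length + 2) ^ p.natDegree) *
            (size A (s, y) + 1) ^ (p.natDegree + 1) := by omega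
      _ = _ := by ring

/-! ### The reduction attached to a selection -/

/-- A parameter transformation assigning to every `s ∈ S` an `s' ∈ S'` with `(s, s') ∈ U`. -/
structure IsSelection {A : Type} (X Y : CaseProblem A) (U : Set (List A × List A))
    (e : List A → Option (List A)) : Prop where
  spec : ∀ s s', e s = some s' → s ∈ X.S ∧ s' ∈ Y.S ∧ (s, s') ∈ U
  ne_none : ∀ s ∈ X.S, e s ≠ none

section Selection

variable {A : Type} {X Y : CaseProblem A} {U : Set (List A × List A)}
  {r : List A × List A × List A →. List A} {e : List A → Option (List A)}

open Classical in
/-- The reduction given by a selection of parameters, with `p₀` as the image of the instances to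
whose parameter nothing is assigned. -/
noncomputable def selectionMap (r : List A × List A × List A →. List A)
    (e : List A → Option (List A)) (p₀ x : List A × List A) : List A × List A :=
  (e x.1).elim p₀ fun s' =>
    (s', if h : (r (x.1, s', x.2)).Dom then (r (x.1, s', x.2)).get h else [])

theorem selectionMap_of_none (p₀ : List A × List A) {s : List A} (y : List A) (h : e s = none) :
    selectionMap r e p₀ (s, y) = p₀ := by
  simp [selectionMap, h]

theorem selectionMap_of_some [Primcodable A] (hr : IsSliceReduction X Y U r) (he : IsSelection X Y U e)
    (p₀ : List A × List A) {s s' : List A} (y : List A) (h : e s = some s') :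
    ∃ z ∈ r (s, s', y), selectionMap r e p₀ (s, y) = (s', z) := by
  have hd : (r (s, s', y)).Dom := by
    have : (s, s', y) ∈ r.Dom := by
      rw [hr.dom_eq]
      exact (he.spec _ _ h).2.2
    exact this
  exact ⟨_, Part.get_mem hd, by simp [selectionMap, h, hd]⟩

/-- Where `e` is defined, both parameters lie in their sets and only correctness is left; elsewhere
`s ∉ S`, and neither the instance nor `p₀` is in its language. -/
theorem mem_lang_iff_selectionMap [Primcodable A] (hr : IsSliceReduction X Y U r) (he : IsSelection X Y U e)
    {p₀ : List A × List A} (hp₀ : p₀ ∉ Y.toParam.lang) (x : List A × List A) :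
    x ∈ X.toParam.lang ↔ selectionMap r e p₀ x ∈ Y.toParam.lang := by
  obtain ⟨s, y⟩ := x
  cases h : e s with
  | none =>
    rw [selectionMap_of_none p₀ y h]
    exact ⟨fun hx => (he.ne_none s hx.2.1 h).elim, fun hx => (hp₀ hx).elim⟩
  | some s' =>
    obtain ⟨z, hz, hg⟩ := selectionMap_of_some hr he p₀ y h
    obtain ⟨hs, hs', hU⟩ := he.spec _ _ h
    rw [hg]
    have := hr.correctness s s' hU y z hz
    exact ⟨fun hx => ⟨this.1 hx.1, hs', trivial⟩, fun hx => ⟨this.2 hx.1, hs, trivial⟩⟩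

theorem selectionMap_fst (p₀ x : List A × List A) :
    (selectionMap r e p₀ x).1 = (e x.1).getD p₀.1 := by
  cases h : e x.1 <;> simp [selectionMap, h]

end Selection

end SliceReduction

open SliceReduction in
theorem mainTheorem9 {A : Type} [Fintype A] [Primcodable A]
    (X Y : SliceReduction.CaseProblem A)
    (hY : Y.toParam.lang ≠ Set.univ)
    (hXY : SliceReduction.SliceReduces X Y) :
    SliceReduction.NuFPTReduces A X.toParam Y.toParam ∧
      (ComputablePred (fun s => s ∈ X.S) → ComputablePred (fun s => s ∈ Y.S) →
        SliceReduction.FPTReduces A X.toParam Y.toParam) := by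
  classical
  obtain ⟨U, r, hr⟩ := hXY
  obtain ⟨p₀, hp₀⟩ := (Set.ne_univ_iff_exists_notMem _).1 hY
  obtain ⟨f, p, M, hf, hM⟩ := hr.fptComputable
  replace hM := fun x => hM _ x rfl
  let q : Polynomial ℕ := (Polynomial.X + 1) ^ (p.natDegree + 1)
  have hq : ∀ m, q.eval m = (m + 1) ^ (p.natDegree + 1) := fun m => by simp [q]
  constructor
  · choose c hc using hr.coverage
    let e : List A → Option (List A) := fun s => if h : s ∈ X.S then some (c s h) else none
    have he : IsSelection X Y U e := by
      refine ⟨fun s s' h => ?_, fun s hs => by simp [e, hs]⟩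
      by_cases hs : s ∈ X.S
      · simp only [e, hs, dite_true, Option.some.injEq] at h
        subst h
        exact ⟨hs, hc s hs⟩
      · simp [e, hs] at h
    -- The chosen `e` need not be computable, but each constant map with value `e k` is. The machine
    -- `N k` is used only on parameter `k`, hence the bound `F k k`.
    choose N F hF using fun k => exists_combined_machine hM p₀ (Computable.const (e k))
    refine ⟨selectionMap r e p₀, fun k => {(e k).getD p₀.1}, ⟨fun k => F k k, q, fun k => ⟨N k, ?_⟩⟩,
      mem_lang_iff_selectionMap hr he hp₀, fun x => Finset.mem_singleton.2 (selectionMap_fst p₀ x)⟩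
    rintro ⟨s, y⟩ rfl z hz
    obtain rfl := Part.mem_some_iff.1 hz
    rw [hq]
    cases h : e s with
    | none =>
      rw [selectionMap_of_none p₀ y h]
      exact (hF s).2.1 s y h
    | some s' =>
      obtain ⟨z, hz, hg⟩ := selectionMap_of_some hr he p₀ y h
      rw [hg]
      exact (hF s).2.2 s y s' z h hz
  · intro hS hS'
    obtain ⟨e, hcomp, hspec, hne⟩ := exists_computable_selection hS hS' hr.enumerable hr.coverage
    have he : IsSelection X Y U e := ⟨hspec, hne⟩
    obtain ⟨N, F, hF, hnone, hsome⟩ := exists_combined_machine hM p₀ hcomp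
    refine ⟨selectionMap r e p₀, fun k => {(e k).getD p₀.1}, ⟨F, q, N, hF hf, ?_⟩,
      ⟨fun k => [(e k).getD p₀.1], ?_, fun k y => by simp⟩,
      mem_lang_iff_selectionMap hr he hp₀, fun x => Finset.mem_singleton.2 (selectionMap_fst p₀ x)⟩
    · rintro k ⟨s, y⟩ rfl z hz
      obtain rfl := Part.mem_some_iff.1 hz
      rw [hq]
      cases h : e s with
      | none =>
        rw [selectionMap_of_none p₀ y h]
        exact hnone s y h
      | some s' =>
        obtain ⟨z, hz, hg⟩ := selectionMap_of_some hr he p₀ y h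
        rw [hg]
        exact hsome s y s' z h hz
    · exact Computable.list_cons.comp (Computable.option_getD hcomp (Computable.const _))
        (Computable.const [])
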